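/- **Setting.** Let $\Omega\subset\mathbb R^d$, $d\in\{2,3\}$, be a bounded domain (open and connected) whose boundary $\Gamma=\partial\Omega$ is of class $C^{k,1}$ for some $k\ge 3$, with outward unit normal $\mathbf n$, surface measure $dS$, surface gradient $\nabla_\Gamma$ and Laplace–Beltrami operator $\Delta_\Gamma$. Let $\varepsilon,\delta,\kappa,K,s_1,s_2,T>0$, and let $F,G\in C^2(\mathbb R)$ be such that $F''$ and $G''$ are bounded and Lipschitz continuous on $\mathbb R$. The KLLM model (the Cahn–Hilliard equation with reaction rate dependent dynamic boundary conditions) is the system $$\phi_t=\Delta\mu,\qquad \mu=-\varepsilon\Delta\phi+\tfrac1\varepsilon F'(\phi)\qquad\text{in }\Omega,$$ $$K\partial_{\mathbf n}\mu=\mu_\Gamma-\mu,\qquad \phi|_\Gamma=\psi,\qquad \psi_t=\Delta_\Gamma\mu_\Gamma-\partial_{\mathbf n}\mu,\qquad \mu_\Gamma=-\delta\kappa\Delta_\Gamma\psi+\tfrac1\delta G'(\psi)+\varepsilon\partial_{\mathbf n}\phi\qquad\text{on }\Gamma .$$ **Exact solution.** Let $(\phi,\psi,\mu,\mu_\Gamma)$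 be a solution of this system on $(0,T]$, with $\phi(t),\mu(t)\in H^1(\Omega)$ and $\psi(t),\mu_\Gamma(t)\in H^1(\Gamma)$, and with $\Delta\phi,\Delta\mu\in L^2(\Omega)$ and $\Delta_\Gamma\psi,\Delta_\Gamma\mu_\Gamma,\partial_{\mathbf n}\phi,\partial_{\mathbf n}\mu\in L^2(\Gamma)$ at each time, so that the equations hold almost everywhere in $\Omega$ and on $\Gamma$. (The distributional Laplacian, the weak Laplace–Beltrami operator, and the normal derivative defined by Green's formula are used.) Assume that it is smooth in the sense that $$\phi,\phi_t,\phi_{tt}\in L^\infty(0,T;H^1(\Omega)),\quad \psi,\psi_t,\psi_{tt}\in L^\infty(0,T;H^1(\Gamma)),$$ and that $\nabla\phi(t)$ and $\nabla_\Gamma\psi(t)$ are essentially bounded, uniformly in $t\in[0,T]$. (This holds in particular if $\phi,\phi_t,\phi_{tt}\in L^\infty(0,T;H^{m}(\Omega))$ and $\psi,\psi_t,\psi_{tt}\in L^\infty(0,T;H^{m-1/2}(\Gamma))$ for some $m\ge 7/2$.) **Scheme.** For an integer $N\ge1$ put $\tau=T/N$ and $t^n=n\tau$. A solution of the scheme consists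 of $\phi^n\in H^1(\Omega)$, $\psi^n\in H^1(\Gamma)$ $(0\le n\le N)$ and $\mu^n\in H^1(\Omega)$, $\mu_\Gamma^n\in H^1(\Gamma)$ $(1\le n\le N)$ with $\phi^0=\phi(0)$, $\psi^0=\psi(0)$ which satisfy, for $0\le n<N$ and in the same sense as above, $$\frac{\phi^{n+1}-\phi^n}{\tau}=\Delta\mu^{n+1},\qquad \mu^{n+1}=-\varepsilon\Delta\phi^{n+1}+\tfrac1\varepsilon F'(\phi^n)+s_1(\phi^{n+1}-\phi^n)\qquad\text{in }\Omega,$$ $$K\partial_{\mathbf n}\mu^{n+1}=\mu_\Gamma^{n+1}-\mu^{n+1},\qquad \phi^{n+1}|_\Gamma=\psi^{n+1},\qquad \frac{\psi^{n+1}-\psi^n}{\tau}=\Delta_\Gamma\mu_\Gamma^{n+1}-\partial_{\mathbf n}\mu^{n+1}\qquad\text{on }\Gamma,$$ $$\mu_\Gamma^{n+1}=-\delta\kappa\Delta_\Gamma\psi^{n+1}+\tfrac1\delta G'(\psi^n)+\varepsilon\partial_{\mathbf n}\phi^{n+1}+s_2(\psi^{n+1}-\psi^n)\qquad\text{on }\Gamma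 .$$ **Theorem.** There are $\tau_0>0$ and a constant $C$, both independent of $\tau$ and of the solution of the scheme, such that for every $N\ge 1$ with $\tau=T/N<\tau_0$ and every solution of the scheme, the errors $e_\phi^n=\phi(t^n)-\phi^n$ and $e_\psi^n=\psi(t^n)-\psi^n$ satisfy $$\max_{0\le n\le N}\|e_\phi^n\|_{H^1(\Omega)}+\max_{0\le n\le N}\|e_\psi^n\|_{H^1(\Gamma)}\le C\,\tau .$$ -/

import Mathlib

open MeasureTheory Set
open scoped ContDiff InnerProductSpace NNReal

noncomputable section

namespace KLLM

/-! ### The domain and its boundary -/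

/-- `Ω` has a boundary of class `C^{k,1}`: near every boundary point, `Ω` is the sublevel set
`{ρ < 0}` of a function `ρ` which is `C^k` with Lipschitz `k`-th derivative and has nonvanishing
gradient at that point. By the implicit function theorem this says that `Ω` lies locally on one
side of the graph of a `C^{k,1}` function. -/
def HasBoundaryCkLip {d : ℕ} (k : ℕ) (Ω : Set (EuclideanSpace ℝ (Fin d))) : Prop :=
  ∀ x₀ ∈ frontier Ω, ∃ (U : Set (EuclideanSpace ℝ (Fin d))) (ρ : EuclideanSpace ℝ (Fin d) → ℝ),
    IsOpen U ∧ x₀ ∈ U ∧ ContDiffOn ℝ k ρ U ∧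
    (∃ L : ℝ≥0, LipschitzOnWith L (iteratedFDeriv ℝ k ρ) U) ∧
    fderiv ℝ ρ x₀ ≠ 0 ∧ Ω ∩ U = {x ∈ U | ρ x < 0}

/-- Lebesgue measure on `Ω`. -/
abbrev bulkMeasure {d : ℕ} (Ω : Set (EuclideanSpace ℝ (Fin d))) :
    Measure (EuclideanSpace ℝ (Fin d)) :=
  volume.restrict Ω

/-- The surface measure `dS` on `Γ = ∂Ω`: the `(d-1)`-dimensional Hausdorff measure, normalised so
that it is the usual length (`d = 2`) or area (`d = 3`), restricted to `Γ`. -/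
abbrev surfaceMeasure {d : ℕ} (Ω : Set (EuclideanSpace ℝ (Fin d))) :
    Measure (EuclideanSpace ℝ (Fin d)) :=
  (Measure.euclideanHausdorffMeasure (d - 1) : Measure (EuclideanSpace ℝ (Fin d))).restrict
    (frontier Ω)

/-- The space `L²(Ω)`. -/
abbrev L2Bulk {d : ℕ} (Ω : Set (EuclideanSpace ℝ (Fin d))) := Lp ℝ 2 (bulkMeasure Ω)

/-- The space `L²(Γ)`. -/
abbrev L2Surf {d : ℕ} (Ω : Set (EuclideanSpace ℝ (Fin d))) := Lp ℝ 2 (surfaceMeasure Ω)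

/-- The tangent space `T_xΓ`, spanned by the limit directions of `Γ = ∂Ω` at `x`. -/
def tangentSpace {d : ℕ} (Ω : Set (EuclideanSpace ℝ (Fin d))) (x : EuclideanSpace ℝ (Fin d)) :
    Submodule ℝ (EuclideanSpace ℝ (Fin d)) :=
  Submodule.span ℝ (tangentConeAt ℝ (frontier Ω) x)

/-- The surface gradient `∇_Γ w` of (the restriction to `Γ` of) a `C¹` function `w`: the orthogonal
projection of `∇w` to the tangent space of `Γ`. -/
def surfGrad {d : ℕ} (Ω : Set (EuclideanSpace ℝ (Fin d))) (w : EuclideanSpace ℝ (Fin d) → ℝ)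
    (x : EuclideanSpace ℝ (Fin d)) : EuclideanSpace ℝ (Fin d) :=
  (tangentSpace Ω x).starProjection (gradient w x)

/-! ### Sobolev spaces -/

/-- `g` is the weak gradient of `u` in `Ω`:
`∫_Ω u ∂_vη = -∫_Ω (g·v) η` for all `η ∈ C_c^∞(Ω)` and all directions `v`. -/
def IsWeakGrad {d : ℕ} (Ω : Set (EuclideanSpace ℝ (Fin d))) (u : L2Bulk Ω)
    (g : Lp (EuclideanSpace ℝ (Fin d)) 2 (bulkMeasure Ω)) : Prop :=
  ∀ η : EuclideanSpace ℝ (Fin d) → ℝ, ContDiff ℝ ∞ η → HasCompactSupport η → tsupport η ⊆ Ω →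
    ∀ v : EuclideanSpace ℝ (Fin d),
      ∫ x in Ω, u x * fderiv ℝ η x v = - ∫ x in Ω, ⟪g x, v⟫_ℝ * η x

lemma integrable_mul_bdd {X : Type*} [MeasurableSpace X] [TopologicalSpace X] [BorelSpace X]
    {μ : Measure X} [IsFiniteMeasureOnCompacts μ] {f : X → ℝ}
    (hf : MemLp f 2 μ) {h : X → ℝ} (hc : Continuous h) (hs : HasCompactSupport h) :
    Integrable (fun x => f x * h x) μ :=
  MemLp.integrable_mul (p := 2) (q := 2) hf (hc.memLp_of_hasCompactSupport hs)

/-- The Sobolev space `H¹(Ω)` of all `u ∈ L²(Ω)` with a weak gradient in `L²(Ω)`, realised as the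
space of the pairs `(u, ∇u)`, so that `‖u‖²_{H¹(Ω)} = ‖u‖²_{L²(Ω)} + ‖∇u‖²_{L²(Ω)}`. -/
def H1Bulk {d : ℕ} (Ω : Set (EuclideanSpace ℝ (Fin d))) :
    Submodule ℝ (WithLp 2 (L2Bulk Ω × Lp (EuclideanSpace ℝ (Fin d)) 2 (bulkMeasure Ω))) where
  carrier := {p | IsWeakGrad Ω p.fst p.snd}
  zero_mem' := by
    intro η _ _ _ v
    have h1 : ∀ᵐ x ∂(bulkMeasure Ω), (0 : L2Bulk Ω) x * fderiv ℝ η x v = 0 := by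
      filter_upwards [Lp.coeFn_zero ℝ 2 (bulkMeasure Ω)] with x hx
      rw [hx, Pi.zero_apply, zero_mul]
    have h2 : ∀ᵐ x ∂(bulkMeasure Ω),
        ⟪(0 : Lp (EuclideanSpace ℝ (Fin d)) 2 (bulkMeasure Ω)) x, v⟫_ℝ * η x = 0 := by
      filter_upwards [Lp.coeFn_zero (EuclideanSpace ℝ (Fin d)) 2 (bulkMeasure Ω)] with x hx
      rw [hx, Pi.zero_apply, inner_zero_left, zero_mul]
    change ∫ x in Ω, (0 : L2Bulk Ω) x * fderiv ℝ η x v = - ∫ x in Ω,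
      ⟪(0 : Lp (EuclideanSpace ℝ (Fin d)) 2 (bulkMeasure Ω)) x, v⟫_ℝ * η x
    rw [integral_congr_ae h1, integral_congr_ae h2]
    simp
  add_mem' := by
    intro p q hp hq η h1 h2 h3 v
    have hd : Continuous fun x => fderiv ℝ η x v :=
      (h1.continuous_fderiv (by simp)).clm_apply continuous_const
    have hds : HasCompactSupport fun x => fderiv ℝ η x v :=
      (h2.fderiv (𝕜 := ℝ)).comp_left (g := fun L : EuclideanSpace ℝ (Fin d) →L[ℝ] ℝ => L v) rfl
    have e1 : ∀ᵐ x ∂(bulkMeasure Ω), (p + q).fst x * fderiv ℝ η x v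
        = p.fst x * fderiv ℝ η x v + q.fst x * fderiv ℝ η x v := by
      filter_upwards [Lp.coeFn_add p.fst q.fst] with x hx
      rw [WithLp.add_fst, hx, Pi.add_apply]; ring
    have e2 : ∀ᵐ x ∂(bulkMeasure Ω), ⟪(p + q).snd x, v⟫_ℝ * η x
        = ⟪p.snd x, v⟫_ℝ * η x + ⟪q.snd x, v⟫_ℝ * η x := by
      filter_upwards [Lp.coeFn_add p.snd q.snd] with x hx
      rw [WithLp.add_snd, hx, Pi.add_apply, inner_add_left]; ring
    have hv : ∀ g : Lp (EuclideanSpace ℝ (Fin d)) 2 (bulkMeasure Ω),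
        MemLp (fun x => ⟪g x, v⟫_ℝ) 2 (bulkMeasure Ω) := fun g => (Lp.memLp g).inner_const v
    rw [integral_congr_ae e1, integral_congr_ae e2,
      integral_add (integrable_mul_bdd (Lp.memLp _) hd hds)
        (integrable_mul_bdd (Lp.memLp _) hd hds),
      integral_add (integrable_mul_bdd (hv _) h1.continuous h2)
        (integrable_mul_bdd (hv _) h1.continuous h2), hp η h1 h2 h3 v, hq η h1 h2 h3 v]
    ring
  smul_mem' := by
    intro c p hp η h1 h2 h3 v
    have e1 : ∀ᵐ x ∂(bulkMeasure Ω), (c • p).fst x * fderiv ℝ η x v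
        = c * (p.fst x * fderiv ℝ η x v) := by
      filter_upwards [Lp.coeFn_smul c p.fst] with x hx
      rw [WithLp.smul_fst, hx, Pi.smul_apply, smul_eq_mul]; ring
    have e2 : ∀ᵐ x ∂(bulkMeasure Ω), ⟪(c • p).snd x, v⟫_ℝ * η x
        = c * (⟪p.snd x, v⟫_ℝ * η x) := by
      filter_upwards [Lp.coeFn_smul c p.snd] with x hx
      rw [WithLp.smul_snd, hx, Pi.smul_apply, real_inner_smul_left]; ring
    rw [integral_congr_ae e1, integral_congr_ae e2, integral_const_mul, integral_const_mul,
      hp η h1 h2 h3 v]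
    ring

/-- The restrictions to `Γ` of `C¹` functions `w` with `w, ∇_Γ w ∈ L²(Γ)`, as pairs
`(w, ∇_Γ w)`. -/
def C1Surf {d : ℕ} (Ω : Set (EuclideanSpace ℝ (Fin d))) :
    Submodule ℝ (WithLp 2 (L2Surf Ω × Lp (EuclideanSpace ℝ (Fin d)) 2 (surfaceMeasure Ω))) where
  carrier := {p | ∃ w : EuclideanSpace ℝ (Fin d) → ℝ, ContDiff ℝ 1 w ∧
    p.fst =ᵐ[surfaceMeasure Ω] w ∧ p.snd =ᵐ[surfaceMeasure Ω] surfGrad Ω w}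
  zero_mem' := by
    refine ⟨fun _ => 0, contDiff_const, ?_, ?_⟩
    · filter_upwards [Lp.coeFn_zero ℝ 2 (surfaceMeasure Ω)] with x hx
      exact hx
    · filter_upwards [Lp.coeFn_zero (EuclideanSpace ℝ (Fin d)) 2 (surfaceMeasure Ω)] with x hx
      simpa [surfGrad, gradient] using hx
  add_mem' := by
    rintro p q ⟨w, hw, h1, h2⟩ ⟨w', hw', h1', h2'⟩
    refine ⟨fun x => w x + w' x, hw.add hw', ?_, ?_⟩
    · filter_upwards [Lp.coeFn_add p.fst q.fst, h1, h1'] with x hx a a'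
      rw [WithLp.add_fst, hx, Pi.add_apply, a, a']
    · filter_upwards [Lp.coeFn_add p.snd q.snd, h2, h2'] with x hx a a'
      rw [WithLp.add_snd, hx, Pi.add_apply, a, a']
      have := fderiv_fun_add (hw.differentiable one_ne_zero x)
        (hw'.differentiable one_ne_zero x)
      simp [surfGrad, gradient, this]
  smul_mem' := by
    rintro c p ⟨w, hw, h1, h2⟩
    refine ⟨fun x => c * w x, contDiff_const.mul hw, ?_, ?_⟩
    · filter_upwards [Lp.coeFn_smul c p.fst, h1] with x hx a
      rw [WithLp.smul_fst, hx, Pi.smul_apply, a, smul_eq_mul]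
    · filter_upwards [Lp.coeFn_smul c p.snd, h2] with x hx a
      rw [WithLp.smul_snd, hx, Pi.smul_apply, a]
      have := fderiv_const_mul (hw.differentiable one_ne_zero x) c
      simp [surfGrad, gradient, this]

/-- The Sobolev space `H¹(Γ)`, the completion of `C¹(Γ)` in the norm
`‖u‖²_{H¹(Γ)} = ‖u‖²_{L²(Γ)} + ‖∇_Γ u‖²_{L²(Γ)}`, realised as a space of pairs `(u, ∇_Γ u)`. -/
def H1Surf {d : ℕ} (Ω : Set (EuclideanSpace ℝ (Fin d))) :
    Submodule ℝ (WithLp 2 (L2Surf Ω × Lp (EuclideanSpace ℝ (Fin d)) 2 (surfaceMeasure Ω))) :=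
  (C1Surf Ω).topologicalClosure

/-- The function `u` underlying an element `(u, ∇u)` of `H¹(Ω)` or `(u, ∇_Γ u)` of `H¹(Γ)`. -/
def fn {A B : Type*} [NormedAddCommGroup A] [NormedSpace ℝ A] [NormedAddCommGroup B]
    [NormedSpace ℝ B] {S : Submodule ℝ (WithLp 2 (A × B))} (u : S) : A :=
  u.1.fst

/-- The gradient of an element `(u, ∇u)` of `H¹(Ω)`, or the surface gradient of an element
`(u, ∇_Γ u)` of `H¹(Γ)`. -/
def grad {A B : Type*} [NormedAddCommGroup A] [NormedSpace ℝ A] [NormedAddCommGroup B]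
    [NormedSpace ℝ B] {S : Submodule ℝ (WithLp 2 (A × B))} (u : S) : B :=
  u.1.snd

/-! ### Traces, Laplacians and normal derivatives -/

/-- `u|_Γ = g`, that is, `g ∈ L²(Γ)` is the trace of `u ∈ H¹(Ω)`: the pair `(u, g)` is a limit in
`H¹(Ω) × L²(Γ)` of pairs `(w|_Ω, w|_Γ)` with `w` of class `C¹` up to the boundary. This is the
graph of the usual trace operator, the continuous extension of `w ↦ w|_Γ`. -/
def HasTrace {d : ℕ} {Ω : Set (EuclideanSpace ℝ (Fin d))} (u : H1Bulk Ω) (g : L2Surf Ω) : Prop :=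
  (u, g) ∈ closure {p : H1Bulk Ω × L2Surf Ω | ∃ w : EuclideanSpace ℝ (Fin d) → ℝ,
    ContDiff ℝ 1 w ∧ (∀ᵐ x ∂(bulkMeasure Ω), fn p.1 x = w x) ∧
    (∀ᵐ x ∂(bulkMeasure Ω), grad p.1 x = gradient w x) ∧
    (∀ᵐ x ∂(surfaceMeasure Ω), p.2 x = w x)}

/-- `Δu = f` in `Ω` in the sense of distributions, with `f ∈ L²(Ω)`. -/
def IsLaplacian {d : ℕ} {Ω : Set (EuclideanSpace ℝ (Fin d))} (u : H1Bulk Ω) (f : L2Bulk Ω) :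
    Prop :=
  ∀ η : EuclideanSpace ℝ (Fin d) → ℝ, ContDiff ℝ ∞ η → HasCompactSupport η → tsupport η ⊆ Ω →
    ∫ x in Ω, f x * η x = - ∫ x in Ω, ⟪grad u x, gradient η x⟫_ℝ

/-- `∂_𝐧 u = h` on `Γ`, with `h ∈ L²(Γ)`: the derivative of `u` in the direction of the outward
unit normal, in the usual weak sense for functions `u ∈ H¹(Ω)` with `Δu ∈ L²(Ω)`, that is,
`(h, v)_Γ = (Δu, v)_Ω + (∇u, ∇v)_Ω` for all `v` of class `C¹` up to the boundary. For a function
`u` that is smooth up to the boundary this is `h = ∇u · 𝐧`, by the divergence theorem. -/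
def IsNormalDeriv {d : ℕ} {Ω : Set (EuclideanSpace ℝ (Fin d))} (u : H1Bulk Ω) (h : L2Surf Ω) :
    Prop :=
  ∃ f : L2Bulk Ω, IsLaplacian u f ∧
    ∀ v : EuclideanSpace ℝ (Fin d) → ℝ, ContDiff ℝ 1 v →
      ∫ x, h x * v x ∂(surfaceMeasure Ω) =
        (∫ x in Ω, f x * v x) + ∫ x in Ω, ⟪grad u x, gradient v x⟫_ℝ

/-- `Δ_Γ u = f` on the closed hypersurface `Γ` in the weak sense, with the Laplace–Beltrami
operator `Δ_Γ` and `f ∈ L²(Γ)`. -/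
def IsSurfLaplacian {d : ℕ} {Ω : Set (EuclideanSpace ℝ (Fin d))} (u : H1Surf Ω) (f : L2Surf Ω) :
    Prop :=
  ∀ v : EuclideanSpace ℝ (Fin d) → ℝ, ContDiff ℝ 1 v →
    ∫ x, f x * v x ∂(surfaceMeasure Ω) =
      - ∫ x, ⟪grad u x, surfGrad Ω v x⟫_ℝ ∂(surfaceMeasure Ω)

/-! ### The KLLM model -/

/-- The six equations of the KLLM model at a fixed time, where `φ, μ, ψ, μΓ` are the values of the
unknowns and `φt, ψt` those of the time derivatives. -/
def KLLMSystem {d : ℕ} (Ω : Set (EuclideanSpace ℝ (Fin d))) (F G : ℝ → ℝ) (ε δ κ K : ℝ)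
    (φ μ : H1Bulk Ω) (ψ μΓ : H1Surf Ω) (φt : H1Bulk Ω) (ψt : H1Surf Ω) : Prop :=
  ∃ (Δφ Δμ : L2Bulk Ω) (Δψ ΔμΓ dnφ dnμ trμ : L2Surf Ω),
    IsLaplacian φ Δφ ∧ IsLaplacian μ Δμ ∧ IsSurfLaplacian ψ Δψ ∧ IsSurfLaplacian μΓ ΔμΓ ∧
    IsNormalDeriv φ dnφ ∧ IsNormalDeriv μ dnμ ∧ HasTrace μ trμ ∧
    (∀ᵐ x ∂(bulkMeasure Ω), fn φt x = Δμ x) ∧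
    (∀ᵐ x ∂(bulkMeasure Ω), fn μ x = -ε * Δφ x + 1 / ε * deriv F (fn φ x)) ∧
    (∀ᵐ x ∂(surfaceMeasure Ω), K * dnμ x = fn μΓ x - trμ x) ∧
    HasTrace φ (fn ψ) ∧
    (∀ᵐ x ∂(surfaceMeasure Ω), fn ψt x = ΔμΓ x - dnμ x) ∧
    (∀ᵐ x ∂(surfaceMeasure Ω),
      fn μΓ x = -(δ * κ) * Δψ x + 1 / δ * deriv G (fn ψ x) + ε * dnφ x)

/-- `(φ, ψ, μ, μΓ)` solves the KLLM model on the time interval `(0, T]`. -/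
def IsKLLMSolution {d : ℕ} (Ω : Set (EuclideanSpace ℝ (Fin d))) (F G : ℝ → ℝ) (ε δ κ K T : ℝ)
    (φ μ : ℝ → H1Bulk Ω) (ψ μΓ : ℝ → H1Surf Ω) : Prop :=
  ∀ t ∈ Ioc 0 T, KLLMSystem Ω F G ε δ κ K (φ t) (μ t) (ψ t) (μΓ t)
    (derivWithin φ (Icc 0 T) t) (derivWithin ψ (Icc 0 T) t)

/-- `u ∈ W^{2,∞}(0,T;X)`, that is `u, u_t, u_tt ∈ L^∞(0,T;X)`, for a Hilbert space `X`: the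
function `u` is differentiable on `[0,T]` and its derivative is Lipschitz continuous. -/
def IsW2Infty {X : Type*} [NormedAddCommGroup X] [NormedSpace ℝ X] (T : ℝ) (u : ℝ → X) : Prop :=
  DifferentiableOn ℝ u (Icc 0 T) ∧
    ∃ L : ℝ≥0, LipschitzOnWith L (derivWithin u (Icc 0 T)) (Icc 0 T)

/-- The regularity of the exact solution:
`φ, φ_t, φ_tt ∈ L^∞(0,T;H¹(Ω))` and `ψ, ψ_t, ψ_tt ∈ L^∞(0,T;H¹(Γ))`, with `∇φ(t)` and `∇_Γ ψ(t)`
essentially bounded, uniformly in `t ∈ [0,T]`. -/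
def IsRegular {d : ℕ} (Ω : Set (EuclideanSpace ℝ (Fin d))) (T : ℝ)
    (φ : ℝ → H1Bulk Ω) (ψ : ℝ → H1Surf Ω) : Prop :=
  IsW2Infty T φ ∧ IsW2Infty T ψ ∧
    ∃ M : ℝ, ∀ t ∈ Icc 0 T,
      (∀ᵐ x ∂(bulkMeasure Ω), ‖grad (φ t) x‖ ≤ M) ∧
      (∀ᵐ x ∂(surfaceMeasure Ω), ‖grad (ψ t) x‖ ≤ M)

/-! ### The stabilized semi-discrete scheme -/

/-- One step `(φ₀, ψ₀) = (φⁿ, ψⁿ) ↦ (φ, ψ, μ, μΓ) = (φⁿ⁺¹, ψⁿ⁺¹, μⁿ⁺¹, μ_Γⁿ⁺¹)` of the scheme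
with time step `τ`. -/
def SchemeStep {d : ℕ} (Ω : Set (EuclideanSpace ℝ (Fin d))) (F G : ℝ → ℝ) (ε δ κ K s₁ s₂ τ : ℝ)
    (φ₀ : H1Bulk Ω) (ψ₀ : H1Surf Ω) (φ μ : H1Bulk Ω) (ψ μΓ : H1Surf Ω) : Prop :=
  ∃ (Δφ Δμ : L2Bulk Ω) (Δψ ΔμΓ dnφ dnμ trμ : L2Surf Ω),
    IsLaplacian φ Δφ ∧ IsLaplacian μ Δμ ∧ IsSurfLaplacian ψ Δψ ∧ IsSurfLaplacian μΓ ΔμΓ ∧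
    IsNormalDeriv φ dnφ ∧ IsNormalDeriv μ dnμ ∧ HasTrace μ trμ ∧
    (∀ᵐ x ∂(bulkMeasure Ω), (fn φ x - fn φ₀ x) / τ = Δμ x) ∧
    (∀ᵐ x ∂(bulkMeasure Ω), fn μ x =
      -ε * Δφ x + 1 / ε * deriv F (fn φ₀ x) + s₁ * (fn φ x - fn φ₀ x)) ∧
    (∀ᵐ x ∂(surfaceMeasure Ω), K * dnμ x = fn μΓ x - trμ x) ∧
    HasTrace φ (fn ψ) ∧
    (∀ᵐ x ∂(surfaceMeasure Ω), (fn ψ x - fn ψ₀ x) / τ = ΔμΓ x - dnμ x) ∧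
    (∀ᵐ x ∂(surfaceMeasure Ω), fn μΓ x =
      -(δ * κ) * Δψ x + 1 / δ * deriv G (fn ψ₀ x) + ε * dnφ x + s₂ * (fn ψ x - fn ψ₀ x))

/-- `(φⁿ, ψⁿ, μⁿ, μ_Γⁿ)`, `0 ≤ n ≤ N`, is a solution of the scheme with `N` steps of size `τ`,
started at `(φinit, ψinit)` (only the values of `μⁿ, μ_Γⁿ` for `n ≥ 1` matter). -/
def IsSchemeSolution {d : ℕ} (Ω : Set (EuclideanSpace ℝ (Fin d))) (F G : ℝ → ℝ)
    (ε δ κ K s₁ s₂ τ : ℝ) (N : ℕ) (φinit : H1Bulk Ω) (ψinit : H1Surf Ω)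
    (φ μ : ℕ → H1Bulk Ω) (ψ μΓ : ℕ → H1Surf Ω) : Prop :=
  φ 0 = φinit ∧ ψ 0 = ψinit ∧
    ∀ n < N, SchemeStep Ω F G ε δ κ K s₁ s₂ τ (φ n) (ψ n)
      (φ (n + 1)) (μ (n + 1)) (ψ (n + 1)) (μΓ (n + 1))

/-- The discrete norm `‖f‖_{l^∞(X)} = max_{0 ≤ n ≤ N} ‖fⁿ‖_X`. -/
def discreteNorm {X : Type*} [NormedAddCommGroup X] (N : ℕ) (f : ℕ → X) : ℝ :=
  (Finset.range (N + 1)).sup' Finset.nonempty_range_add_one fun n => ‖f n‖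

end KLLM

end

/-! Write e, E for the bulk and surface errors, m, M for the errors of the potentials and h for the
error of ∂ₙμ. Testing the error equations for e, E with m, M produces the dissipation ‖∇m‖² + ‖∇_Γ
M‖² + K‖h‖²; the last term comes from K h = M − m|_Γ. The energy followed in time is ε‖∇e‖² + δκ‖∇_Γ
E‖² + ‖e‖² + ‖E‖².

By Green's formula, the nonlinear and stabilization errors enter only through their gradients,
paired with ∇m or ∇_Γ M, and their boundary values, paired with h, apart from the stabilization
terms in the error increments, which have a favourable sign. Young's inequality absorbs these
pairings into the dissipation (`energy_identity`, `energy_step`). The gradient of the nonlinear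
error is (F''(φ) − F''(φⁿ))∇φ + F''(φⁿ)∇(φ − φⁿ), so a pointwise bound is needed only for the exact
gradient (`BddCont.norm_smulComp_sub_le`).

The consistency errors are O(τ) in H¹ (`IsW2Infty.exists_bound`). Their bulk and surface parts are
compatible at the boundary (`derivWithin_mem_compatible`), hence can be tested against the
Laplacians of e and E. The resulting one-step inequality `energy_sub_energy_le` and
`discrete_gronwall` give an energy of order τ².

Green's formula is needed for test functions such as F'(φ) − F'(0) with φ only in H¹. The test data
for which it holds form a closed subspace (`bulkTest`, `surfTest`), so limits of C¹ functions are
admissible, and so are their compositions (`HasTrace.comp_mem_bulkTest`, `comp_mem_surfTest`). -/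

namespace KLLM

open Filter Topology

/-! ### Products q(u) g in L², as they occur in the chain rule. -/

section SmulComp

variable {X E : Type*} [MeasurableSpace X] {ν : Measure X} [NormedAddCommGroup E]
  [InnerProductSpace ℝ E]

/-- A bounded continuous function, as used for the outer derivative in the chain rule. -/
structure BddCont (q : ℝ → ℝ) (L : ℝ) : Prop where
  continuous : Continuous q
  bound : ∀ x, |q x| ≤ L

lemma BddCont.memLp {q : ℝ → ℝ} {L : ℝ} (hq : BddCont q L) (u : Lp ℝ 2 ν) (g : Lp E 2 ν) :
    MemLp (fun x => q (u x) • g x) 2 ν := by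
  refine (Lp.memLp g).of_le_mul (c := L) ?_ (Eventually.of_forall fun x => ?_)
  · exact (hq.continuous.comp_aestronglyMeasurable (Lp.aestronglyMeasurable u)).smul
      (Lp.aestronglyMeasurable g)
  · rw [norm_smul, Real.norm_eq_abs]
    exact mul_le_mul_of_nonneg_right (hq.bound _) (norm_nonneg _)

/-- The product `q(u) g` as an element of `L²`, for a bounded continuous `q`. -/
noncomputable def BddCont.smulComp {q : ℝ → ℝ} {L : ℝ} (hq : BddCont q L) (u : Lp ℝ 2 ν)
    (g : Lp E 2 ν) : Lp E 2 ν :=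
  (hq.memLp u g).toLp

lemma BddCont.coeFn_smulComp {q : ℝ → ℝ} {L : ℝ} (hq : BddCont q L) (u : Lp ℝ 2 ν)
    (g : Lp E 2 ν) : hq.smulComp u g =ᵐ[ν] fun x => q (u x) • g x :=
  (hq.memLp u g).coeFn_toLp

lemma BddCont.norm_smulComp_le {q : ℝ → ℝ} {L : ℝ} (hq : BddCont q L) (u : Lp ℝ 2 ν)
    (g : Lp E 2 ν) : ‖hq.smulComp u g‖ ≤ L * ‖g‖ := by
  refine Lp.norm_le_mul_norm_of_ae_le_mul ?_
  filter_upwards [hq.coeFn_smulComp u g] with x hx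
  rw [hx, norm_smul, Real.norm_eq_abs]
  exact mul_le_mul_of_nonneg_right (hq.bound _) (norm_nonneg _)

lemma BddCont.smulComp_sub {q : ℝ → ℝ} {L : ℝ} (hq : BddCont q L) (u : Lp ℝ 2 ν)
    (g g' : Lp E 2 ν) : hq.smulComp u (g - g') = hq.smulComp u g - hq.smulComp u g' := by
  refine Lp.ext ?_
  filter_upwards [hq.coeFn_smulComp u g, hq.coeFn_smulComp u g', hq.coeFn_smulComp u (g - g'),
    Lp.coeFn_sub g g', Lp.coeFn_sub (hq.smulComp u g) (hq.smulComp u g')] with x h1 h2 h3 h4 h5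
  rw [h3, h5, Pi.sub_apply, h1, h2, h4, Pi.sub_apply, smul_sub]

lemma BddCont.inner_smulComp {q : ℝ → ℝ} {L : ℝ} (hq : BddCont q L) (G : Lp E 2 ν)
    (u : Lp ℝ 2 ν) (g : Lp E 2 ν) :
    ⟪G, hq.smulComp u g⟫_ℝ = ∫ x, q (u x) * ⟪G x, g x⟫_ℝ ∂ν := by
  rw [L2.inner_def]
  refine integral_congr_ae ?_
  filter_upwards [hq.coeFn_smulComp u g] with x hx
  rw [hx, real_inner_smul_right]

/-- `(u, g) ↦ q(u) g` is strongly-weakly continuous on `L² × L²`. -/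
lemma BddCont.continuous_inner_smulComp {q : ℝ → ℝ} {L : ℝ} (hq : BddCont q L) (G : Lp E 2 ν) :
    Continuous fun z : Lp ℝ 2 ν × Lp E 2 ν => ⟪G, hq.smulComp z.1 z.2⟫_ℝ := by
  rw [continuous_iff_seqContinuous]
  intro z z₀ hz
  -- L² convergence yields a.e. convergence only along a subsequence, which suffices when every
  -- subsequence is tested.
  refine tendsto_of_subseq_tendsto fun ns hns => ?_
  have hz' : Tendsto (z ∘ ns) atTop (𝓝 z₀) := hz.comp hns
  have h1 : Tendsto (fun n => (z (ns n)).1) atTop (𝓝 z₀.1) :=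
    (continuous_fst.tendsto _).comp hz'
  have h2 : Tendsto (fun n => (z (ns n)).2) atTop (𝓝 z₀.2) :=
    (continuous_snd.tendsto _).comp hz'
  obtain ⟨ms, hms, hae⟩ := (tendstoInMeasure_of_tendsto_Lp h1).exists_seq_tendsto_ae
  refine ⟨ms, ?_⟩
  have hL : 0 ≤ L := (abs_nonneg _).trans (hq.bound 0)
  -- Split q(uₙ) gₙ = q(uₙ)(gₙ − g) + q(uₙ) g: the first part is small since q is bounded, the
  -- second converges by dominated convergence.
  have hA : Tendsto (fun n => ⟪G, hq.smulComp (z (ns (ms n))).1 ((z (ns (ms n))).2 - z₀.2)⟫_ℝ)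
      atTop (𝓝 0) := by
    have h3 : Tendsto (fun n => ‖G‖ * (L * ‖(z (ns (ms n))).2 - z₀.2‖)) atTop (𝓝 0) := by
      have := (tendsto_iff_norm_sub_tendsto_zero.1 h2).comp hms.tendsto_atTop
      simpa using (this.const_mul L).const_mul ‖G‖
    refine squeeze_zero_norm (fun n => ?_) h3
    exact (norm_inner_le_norm _ _).trans
      (mul_le_mul_of_nonneg_left (hq.norm_smulComp_le _ _) (norm_nonneg _))
  have hB : Tendsto (fun n => ⟪G, hq.smulComp (z (ns (ms n))).1 z₀.2⟫_ℝ) atTop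
      (𝓝 ⟪G, hq.smulComp z₀.1 z₀.2⟫_ℝ) := by
    simp only [hq.inner_smulComp]
    have hint : Integrable (fun x => ⟪G x, z₀.2 x⟫_ℝ) ν := L2.integrable_inner G z₀.2
    refine tendsto_integral_of_dominated_convergence (fun x => L * ‖⟪G x, z₀.2 x⟫_ℝ‖) ?_
      (hint.norm.const_mul L) ?_ ?_
    · intro n
      exact (hq.continuous.comp_aestronglyMeasurable (Lp.aestronglyMeasurable _)).mul
        hint.aestronglyMeasurable
    · intro n
      refine Eventually.of_forall fun x => ?_
      rw [norm_mul, Real.norm_eq_abs (q _)]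
      exact mul_le_mul_of_nonneg_right (hq.bound _) (norm_nonneg _)
    · filter_upwards [hae] with x hx
      exact (((hq.continuous.tendsto _).comp hx)).mul_const _
  have := hA.add hB
  simp only [← inner_add_right] at this
  simpa [hq.smulComp_sub] using this

end SmulComp

/-! ### The chain rule for C¹ functions. -/

/-- A `C¹` function with bounded derivative which vanishes at `0`. -/
structure ChainFun (p : ℝ → ℝ) (L : ℝ≥0) : Prop where
  contDiff : ContDiff ℝ 1 p
  zero : p 0 = 0
  bound : ∀ x, |deriv p x| ≤ L

lemma ChainFun.lipschitz {p : ℝ → ℝ} {L : ℝ≥0} (hp : ChainFun p L) : LipschitzWith L p :=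
  lipschitzWith_of_nnnorm_deriv_le (hp.contDiff.differentiable one_ne_zero) fun x => by
    simpa [← NNReal.coe_le_coe] using hp.bound x

lemma ChainFun.bddCont {p : ℝ → ℝ} {L : ℝ≥0} (hp : ChainFun p L) : BddCont (deriv p) L :=
  ⟨hp.contDiff.continuous_deriv le_rfl, hp.bound⟩

lemma ChainFun.gradient_comp {d : ℕ} {p : ℝ → ℝ} {L : ℝ≥0} (hp : ChainFun p L)
    {w : EuclideanSpace ℝ (Fin d) → ℝ} (hw : ContDiff ℝ 1 w) (x : EuclideanSpace ℝ (Fin d)) :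
    gradient (fun y => p (w y)) x = deriv p (w x) • gradient w x := by
  have h : HasFDerivAt (fun y => p (w y)) (deriv p (w x) • fderiv ℝ w x) x :=
    ((hp.contDiff.differentiable one_ne_zero (w x)).hasDerivAt).comp_hasFDerivAt x
      (hw.differentiable one_ne_zero x).hasFDerivAt
  rw [gradient, h.fderiv, map_smul, gradient]

lemma ChainFun.surfGrad_comp {d : ℕ} {p : ℝ → ℝ} {L : ℝ≥0} (hp : ChainFun p L)
    (Ω : Set (EuclideanSpace ℝ (Fin d)))
    {w : EuclideanSpace ℝ (Fin d) → ℝ} (hw : ContDiff ℝ 1 w) (x : EuclideanSpace ℝ (Fin d)) :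
    surfGrad Ω (fun y => p (w y)) x = deriv p (w x) • surfGrad Ω w x := by
  rw [surfGrad, hp.gradient_comp hw, map_smul, surfGrad]

/-! ### Green's formulas in the bulk and on the surface. -/

section Tests

variable {d : ℕ} {Ω : Set (EuclideanSpace ℝ (Fin d))}

/-- `IsNormalDeriv` hides a Laplacian of its own under an existential; uniqueness identifies it with
the one in the equations. -/
lemma IsLaplacian.unique (hΩ : IsOpen Ω) {u : H1Bulk Ω} {f f' : L2Bulk Ω}
    (h : IsLaplacian u f) (h' : IsLaplacian u f') : f = f' := by
  have hint : ∀ g : L2Bulk Ω, LocallyIntegrableOn g Ω volume := fun g =>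
    locallyIntegrableOn_of_locallyIntegrable_restrict
      ((Lp.memLp g).locallyIntegrable (by norm_num))
  have key := hΩ.ae_eq_zero_of_integral_contDiff_smul_eq_zero (μ := volume)
    (f := fun x => f x - f' x) ((hint f).sub (hint f')) (fun η h1 h2 h3 => by
      have e : ∀ x ∉ Ω, η x • (f x - f' x) = 0 := fun x hx => by
        rw [image_eq_zero_of_notMem_tsupport (fun hm => hx (h3 hm)), zero_smul]
      rw [← setIntegral_eq_integral_of_forall_compl_eq_zero e]
      have e2 : ∀ x, η x • (f x - f' x) = f x * η x - f' x * η x := fun x => by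
        rw [smul_eq_mul]; ring
      simp only [e2]
      rw [integral_sub (integrable_mul_bdd (Lp.memLp f) h1.continuous h2)
        (integrable_mul_bdd (Lp.memLp f') h1.continuous h2), h η h1 h2 h3, h' η h1 h2 h3, sub_self])
  refine Lp.ext ?_
  rw [EventuallyEq, ae_restrict_iff' hΩ.measurableSet]
  filter_upwards [key] with x hx hm
  exact sub_eq_zero.1 (hx hm)

/-- The triples `(v, ∇v, v|_Γ)` for which Green's formula holds. -/
def bulkTest (Ω : Set (EuclideanSpace ℝ (Fin d))) :
    Submodule ℝ (L2Bulk Ω × Lp (EuclideanSpace ℝ (Fin d)) 2 (bulkMeasure Ω) × L2Surf Ω) where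
  carrier := {z | ∀ (u : H1Bulk Ω) (f : L2Bulk Ω) (h : L2Surf Ω), IsLaplacian u f →
    IsNormalDeriv u h → ⟪h, z.2.2⟫_ℝ = ⟪f, z.1⟫_ℝ + ⟪grad u, z.2.1⟫_ℝ}
  zero_mem' := fun u f h _ _ => by simp
  add_mem' := fun {a b} ha hb u f h h1 h2 => by
    have := ha u f h h1 h2
    have := hb u f h h1 h2
    simp only [Prod.fst_add, Prod.snd_add, inner_add_right]
    linarith
  smul_mem' := fun c a ha u f h h1 h2 => by
    have := ha u f h h1 h2
    simp only [Prod.smul_fst, Prod.smul_snd, real_inner_smul_right]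
    rw [this]; ring

lemma isClosed_bulkTest : IsClosed (SetLike.coe (bulkTest Ω)) := by
  have : SetLike.coe (bulkTest Ω) =
      ⋂ (u : H1Bulk Ω) (f : L2Bulk Ω) (h : L2Surf Ω) (_ : IsLaplacian u f)
        (_ : IsNormalDeriv u h), {z | ⟪h, z.2.2⟫_ℝ = ⟪f, z.1⟫_ℝ + ⟪grad u, z.2.1⟫_ℝ} := by
    ext z; simp only [mem_iInter]; rfl
  rw [this]
  refine isClosed_iInter fun u => isClosed_iInter fun f => isClosed_iInter fun h =>
    isClosed_iInter fun _ => isClosed_iInter fun _ => isClosed_eq ?_ ?_ <;> fun_prop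

lemma mem_bulkTest_of_contDiff (hΩ : IsOpen Ω) {w : EuclideanSpace ℝ (Fin d) → ℝ}
    (hw : ContDiff ℝ 1 w) {a : L2Bulk Ω} {b : Lp (EuclideanSpace ℝ (Fin d)) 2 (bulkMeasure Ω)}
    {c : L2Surf Ω} (ha : ∀ᵐ x ∂(bulkMeasure Ω), a x = w x)
    (hb : ∀ᵐ x ∂(bulkMeasure Ω), b x = gradient w x)
    (hc : ∀ᵐ x ∂(surfaceMeasure Ω), c x = w x) : (a, b, c) ∈ bulkTest Ω := by
  rintro u f h h1 ⟨f', h2, h3⟩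
  obtain rfl := h1.unique hΩ h2
  have := h3 w hw
  simp only [L2.inner_def]
  convert this using 1
  · refine integral_congr_ae ?_
    filter_upwards [hc] with x hx
    rw [hx, real_inner_comm, real_inner_eq_re_inner, RCLike.inner_apply]; simp
  · congr 1
    · refine integral_congr_ae ?_
      filter_upwards [ha] with x hx
      rw [hx, real_inner_comm, real_inner_eq_re_inner, RCLike.inner_apply]; simp
    · refine integral_congr_ae ?_
      filter_upwards [hb] with x hx
      rw [hx]

lemma HasTrace.mem_bulkTest (hΩ : IsOpen Ω) {v : H1Bulk Ω} {g : L2Surf Ω} (h : HasTrace v g) :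
    (fn v, grad v, g) ∈ bulkTest Ω := by
  have hcont : Continuous fun z : H1Bulk Ω × L2Surf Ω => (fn z.1, grad z.1, z.2) := by
    unfold fn grad; fun_prop
  refine closure_minimal ?_ (isClosed_bulkTest.preimage hcont) h
  rintro ⟨u, g⟩ ⟨w, hw, h1, h2, h3⟩
  exact mem_bulkTest_of_contDiff hΩ hw h1 h2 h3

/-- Green's formula holds for `p(v)`, with gradient `p'(v)∇v` and trace `p(v|_Γ)`. -/
lemma HasTrace.comp_mem_bulkTest (hΩ : IsOpen Ω) {p : ℝ → ℝ} {L : ℝ≥0} (hp : ChainFun p L)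
    {v : H1Bulk Ω} {g : L2Surf Ω} (h : HasTrace v g) :
    (hp.lipschitz.compLp hp.zero (fn v), hp.bddCont.smulComp (fn v) (grad v),
      hp.lipschitz.compLp hp.zero g) ∈ bulkTest Ω := by
  intro u f k h1 h2
  have hfn : Continuous fun z : H1Bulk Ω × L2Surf Ω => fn z.1 := by
    unfold fn; fun_prop
  have hgrad : Continuous fun z : H1Bulk Ω × L2Surf Ω => (fn z.1, grad z.1) := by
    unfold fn grad; fun_prop
  -- With u, f, k fixed, the identity for p(v) is a closed condition on (v, g): composition is norm
  -- continuous and the gradient p'(v)∇v is weakly continuous. It remains to treat C¹ functions w,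
  -- for which p ∘ w is again C¹.
  have hclosed : IsClosed {z : H1Bulk Ω × L2Surf Ω |
      ⟪k, hp.lipschitz.compLp hp.zero z.2⟫_ℝ = ⟪f, hp.lipschitz.compLp hp.zero (fn z.1)⟫_ℝ +
        ⟪grad u, hp.bddCont.smulComp (fn z.1) (grad z.1)⟫_ℝ} := by
    refine isClosed_eq ?_ (Continuous.add ?_ ?_)
    · exact continuous_const.inner
        ((hp.lipschitz.continuous_compLp hp.zero).comp continuous_snd)
    · exact continuous_const.inner ((hp.lipschitz.continuous_compLp hp.zero).comp hfn)
    · exact (hp.bddCont.continuous_inner_smulComp (grad u)).comp hgrad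
  refine closure_minimal ?_ hclosed h
  rintro ⟨v, g⟩ ⟨w, hw, e1, e2, e3⟩
  refine mem_bulkTest_of_contDiff hΩ (w := fun x => p (w x)) (hp.contDiff.comp hw) ?_ ?_ ?_
    u f k h1 h2
  · filter_upwards [hp.lipschitz.coeFn_compLp hp.zero (fn v), e1] with x hx h'
    exact hx.trans (congrArg p h')
  · filter_upwards [hp.bddCont.coeFn_smulComp (fn v) (grad v), e1, e2] with x hx h' h''
    refine hx.trans ?_
    rw [hp.gradient_comp hw, ← h', ← h'']
  · filter_upwards [hp.lipschitz.coeFn_compLp hp.zero g, e3] with x hx h'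
    exact hx.trans (congrArg p h')

/-- The pairs `(v, ∇_Γ v)` for which Green's formula on `Γ` holds. -/
def surfTest (Ω : Set (EuclideanSpace ℝ (Fin d))) :
    Submodule ℝ (L2Surf Ω × Lp (EuclideanSpace ℝ (Fin d)) 2 (surfaceMeasure Ω)) where
  carrier := {z | ∀ (u : H1Surf Ω) (f : L2Surf Ω), IsSurfLaplacian u f →
    ⟪f, z.1⟫_ℝ = - ⟪grad u, z.2⟫_ℝ}
  zero_mem' := fun u f _ => by simp
  add_mem' := fun {a b} ha hb u f h1 => by
    have := ha u f h1
    have := hb u f h1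
    simp only [Prod.fst_add, Prod.snd_add, inner_add_right]
    linarith
  smul_mem' := fun c a ha u f h1 => by
    have := ha u f h1
    simp only [Prod.smul_fst, Prod.smul_snd, real_inner_smul_right]
    rw [this]; ring

lemma mem_surfTest_of_contDiff {w : EuclideanSpace ℝ (Fin d) → ℝ}
    (hw : ContDiff ℝ 1 w) {a : L2Surf Ω}
    {b : Lp (EuclideanSpace ℝ (Fin d)) 2 (surfaceMeasure Ω)}
    (ha : ∀ᵐ x ∂(surfaceMeasure Ω), a x = w x)
    (hb : ∀ᵐ x ∂(surfaceMeasure Ω), b x = surfGrad Ω w x) : (a, b) ∈ surfTest Ω := by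
  intro u f h1
  have := h1 w hw
  simp only [L2.inner_def]
  convert this using 1
  · refine integral_congr_ae ?_
    filter_upwards [ha] with x hx
    rw [hx, real_inner_comm, real_inner_eq_re_inner, RCLike.inner_apply]; simp
  · congr 1
    refine integral_congr_ae ?_
    filter_upwards [hb] with x hx
    rw [hx]

/-- Green's formula on `Γ` holds for `p(v)`, with surface gradient `p'(v)∇_Γ v`. -/
lemma comp_mem_surfTest {p : ℝ → ℝ} {L : ℝ≥0} (hp : ChainFun p L) (v : H1Surf Ω) :
    (hp.lipschitz.compLp hp.zero (fn v), hp.bddCont.smulComp (fn v) (grad v)) ∈ surfTest Ω := by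
  intro u f h1
  have hpair : Continuous fun z : WithLp 2 (L2Surf Ω ×
      Lp (EuclideanSpace ℝ (Fin d)) 2 (surfaceMeasure Ω)) => (z.fst, z.snd) := by fun_prop
  have hclosed : IsClosed {z : WithLp 2 (L2Surf Ω ×
      Lp (EuclideanSpace ℝ (Fin d)) 2 (surfaceMeasure Ω)) |
      ⟪f, hp.lipschitz.compLp hp.zero z.fst⟫_ℝ =
        - ⟪grad u, hp.bddCont.smulComp z.fst z.snd⟫_ℝ} := by
    refine isClosed_eq ?_ (Continuous.neg ?_)
    · exact continuous_const.inner ((hp.lipschitz.continuous_compLp hp.zero).comp (by fun_prop))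
    · exact (hp.bddCont.continuous_inner_smulComp (grad u)).comp hpair
  refine closure_minimal ?_ hclosed v.2
  rintro z ⟨w, hw, e1, e2⟩
  refine mem_surfTest_of_contDiff (w := fun x => p (w x)) (hp.contDiff.comp hw) ?_ ?_ u f h1
  · filter_upwards [hp.lipschitz.coeFn_compLp hp.zero z.fst, e1] with x hx h'
    exact hx.trans (congrArg p h')
  · filter_upwards [hp.bddCont.coeFn_smulComp z.fst z.snd, e1, e2] with x hx h' h''
    refine hx.trans ?_
    rw [hp.surfGrad_comp Ω hw, ← h', ← h'']

/-- `H1Surf` is by definition a closure of C¹ pairs, so no condition like `HasTrace` is needed. -/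
lemma mem_surfTest (v : H1Surf Ω) : (fn v, grad v) ∈ surfTest Ω := by
  intro u f h1
  have hclosed : IsClosed {z : WithLp 2 (L2Surf Ω ×
      Lp (EuclideanSpace ℝ (Fin d)) 2 (surfaceMeasure Ω)) |
      ⟪f, z.fst⟫_ℝ = - ⟪grad u, z.snd⟫_ℝ} := by
    refine isClosed_eq ?_ ?_ <;> fun_prop
  refine closure_minimal ?_ hclosed v.2
  rintro z ⟨w, hw, e1, e2⟩
  exact mem_surfTest_of_contDiff hw e1 e2 u f h1

end Tests

/-! ### The one-step energy estimate in abstract inner product spaces. -/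

section EnergyStep

variable {H V B W : Type*} [NormedAddCommGroup H] [InnerProductSpace ℝ H]
  [NormedAddCommGroup V] [InnerProductSpace ℝ V] [NormedAddCommGroup B] [InnerProductSpace ℝ B]
  [NormedAddCommGroup W] [InnerProductSpace ℝ W]

/-- The energy identity for one step of the error equations. Here `D, Ψ` are the increments of the
errors `e, E`, the potentials are `m, M`, the consistency errors `R, S`, the nonlinear terms
`P, Q`, and `A, A'` are the increments of the exact solution in the bulk and on the surface. -/
lemma energy_identity {ε ν δ K s₁ s₂ τ : ℝ}
    {e D m Le Lm P A R : H} {ge gD gm gP gA gR : V}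
    {E Ψ M LE LM P' Q A' S h k m' : B} {gE gΨ gM gQ gA' gS : W}
    (eqD : D = τ • (Lm + R)) (eqΨ : Ψ = τ • (LM - h + S))
    (eqm : m = -ε • Le + (1 / ε) • P + s₁ • (D - A))
    (eqM : M = -ν • LE + (1 / δ) • Q + ε • k + s₂ • (Ψ - A'))
    (eqK : K • h = M - m')
    (mm : ⟪h, m'⟫_ℝ = ⟪Lm, m⟫_ℝ + ⟪gm, gm⟫_ℝ) (mP : ⟪h, P'⟫_ℝ = ⟪Lm, P⟫_ℝ + ⟪gm, gP⟫_ℝ)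
    (mA : ⟪h, A'⟫_ℝ = ⟪Lm, A⟫_ℝ + ⟪gm, gA⟫_ℝ) (me : ⟪h, E⟫_ℝ = ⟪Lm, e⟫_ℝ + ⟪gm, ge⟫_ℝ)
    (eD : ⟪k, Ψ⟫_ℝ = ⟪Le, D⟫_ℝ + ⟪ge, gD⟫_ℝ) (eR : ⟪k, S⟫_ℝ = ⟪Le, R⟫_ℝ + ⟪ge, gR⟫_ℝ)
    (MM : ⟪LM, M⟫_ℝ = -⟪gM, gM⟫_ℝ) (MQ : ⟪LM, Q⟫_ℝ = -⟪gM, gQ⟫_ℝ)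
    (MA : ⟪LM, A'⟫_ℝ = -⟪gM, gA'⟫_ℝ) (ME : ⟪LM, E⟫_ℝ = -⟪gM, gE⟫_ℝ)
    (EΨ : ⟪LE, Ψ⟫_ℝ = -⟪gE, gΨ⟫_ℝ) (ES : ⟪LE, S⟫_ℝ = -⟪gE, gS⟫_ℝ) :
    ε * ⟪ge, gD⟫_ℝ + ν * ⟪gE, gΨ⟫_ℝ + ⟪e, D⟫_ℝ + ⟪E, Ψ⟫_ℝ + s₁ * ‖D‖ ^ 2 + s₂ * ‖Ψ‖ ^ 2 =
      τ * (-‖gm‖ ^ 2 - ‖gM‖ ^ 2 - K * ‖h‖ ^ 2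
        + (1 / ε * ⟪gm, gP⟫_ℝ - s₁ * ⟪gm, gA⟫_ℝ - ⟪gm, ge⟫_ℝ)
        + (1 / δ * ⟪gM, gQ⟫_ℝ - s₂ * ⟪gM, gA'⟫_ℝ - ⟪gM, gE⟫_ℝ)
        + (-(1 / ε) * ⟪h, P'⟫_ℝ + s₁ * ⟪h, A'⟫_ℝ + 1 / δ * ⟪h, Q⟫_ℝ - s₂ * ⟪h, A'⟫_ℝ)
        + (ε * ⟪ge, gR⟫_ℝ + ν * ⟪gE, gS⟫_ℝ + s₁ * ⟪R, D⟫_ℝ + s₂ * ⟪S, Ψ⟫_ℝ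
          + ⟪R, e⟫_ℝ + ⟪S, E⟫_ℝ)) := by
  have i1 : ⟪Lm, m⟫_ℝ = -ε * ⟪Lm, Le⟫_ℝ + 1 / ε * ⟪Lm, P⟫_ℝ + s₁ * (⟪Lm, D⟫_ℝ - ⟪Lm, A⟫_ℝ) := by
    conv_lhs => rw [eqm]
    simp only [inner_add_right, inner_sub_right, real_inner_smul_right]
  have i (x : H) : ⟪D, x⟫_ℝ = τ * (⟪Lm, x⟫_ℝ + ⟪R, x⟫_ℝ) := by
    rw [eqD, real_inner_smul_left, inner_add_left]
  have j (x : B) : ⟪Ψ, x⟫_ℝ = τ * (⟪LM, x⟫_ℝ - ⟪h, x⟫_ℝ + ⟪S, x⟫_ℝ) := by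
    rw [eqΨ, real_inner_smul_left, inner_add_left, inner_sub_left]
  have j1 (y : B) : ⟪y, M⟫_ℝ = -ν * ⟪y, LE⟫_ℝ + 1 / δ * ⟪y, Q⟫_ℝ + ε * ⟪y, k⟫_ℝ
      + s₂ * (⟪y, Ψ⟫_ℝ - ⟪y, A'⟫_ℝ) := by
    conv_lhs => rw [eqM]
    simp only [inner_add_right, inner_sub_right, real_inner_smul_right]
  have kk : K * ⟪h, h⟫_ℝ = ⟪h, M⟫_ℝ - ⟪h, m'⟫_ℝ := by
    rw [← real_inner_smul_right, eqK, inner_sub_right]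
  have i2 := i Le
  have i3 := i D
  have i4 := i e
  have j2 := j LE
  have j3 := j k
  have j4 := j Ψ
  have j5 := j E
  have j6 := j1 LM
  have j7 := j1 h
  rw [real_inner_comm] at i2 i4 j2 j3 j5
  rw [real_inner_comm R Le, real_inner_comm S LE, real_inner_comm S k] at *
  simp only [← real_inner_self_eq_norm_sq]
  -- The flux ε k in M cancels the boundary term of `eD`. Since E carries the boundary values of e,
  -- `me` removes ⟨h, E⟩. The remaining ⟨h, M − m'⟩ is K‖h‖² by `kk`, and `eR`, `ES` replace the
  -- Laplacians paired with R, S by gradients.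
  linear_combination (-ε) * eD + τ * ε * eR + ν * EΨ - τ * ν * ES + s₁ * i3 + s₂ * j4 + i4 + j5
    - ε * i2 - ν * j2 + ε * j3 - τ * i1 - τ * j6 + τ * j7 - τ * mm + τ * MM + τ * kk
    - τ * me + τ / ε * mP - τ * s₁ * mA - τ / δ * MQ + τ * s₂ * MA + τ * ME

/-- The constant in the one-step energy estimate. -/
noncomputable def stepConst (ε ν δ K s₁ s₂ c : ℝ) : ℝ :=
  -- In order: the Young remainders of the pairings with gm, gM and h, then the consistency terms.
  ((1 / ε + s₁) * c + 1) ^ 2 / 4 + ((1 / δ + s₂) * c + 1) ^ 2 / 4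
    + ((1 / ε + s₁ + 1 / δ + s₂) * c) ^ 2 / (4 * K) + (ε + ν + s₁ + s₂ + 2) * c

lemma young {a x K : ℝ} (hK : 0 < K) : a * x ≤ K * a ^ 2 + x ^ 2 / (4 * K) := by
  have : K * a ^ 2 + x ^ 2 / (4 * K) - a * x = (2 * K * a - x) ^ 2 / (4 * K) := by
    field_simp; ring
  have h : 0 ≤ (2 * K * a - x) ^ 2 / (4 * K) := by positivity
  linarith

lemma inner_le_of_norm_le {G : Type*} [NormedAddCommGroup G] [InnerProductSpace ℝ G] {x y : G}
    {r : ℝ} (hy : ‖y‖ ≤ r) : |⟪x, y⟫_ℝ| ≤ ‖x‖ * r :=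
  (abs_real_inner_le_norm x y).trans (mul_le_mul_of_nonneg_left hy (norm_nonneg _))

lemma inner_le_of_norm_le_of_norm_le {G : Type*} [NormedAddCommGroup G] [InnerProductSpace ℝ G]
    {x y : G} {r s : ℝ} (hx : ‖x‖ ≤ s) (hy : ‖y‖ ≤ r) : |⟪x, y⟫_ℝ| ≤ s * r :=
  (inner_le_of_norm_le hy).trans (mul_le_mul_of_nonneg_right hx ((norm_nonneg _).trans hy))

/-- With y the increment of x, this is the telescoping inequality of implicit Euler; the term ‖y‖²
is dropped. -/
lemma sq_sub_sq_le_inner {G : Type*} [NormedAddCommGroup G] [InnerProductSpace ℝ G] (x y : G) :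
    ‖x‖ ^ 2 - ‖x - y‖ ^ 2 ≤ 2 * ⟪x, y⟫_ℝ := by
  rw [norm_sub_sq_real]
  nlinarith [sq_nonneg ‖y‖]

/-- The one-step energy estimate: the energy identity, with all right-hand sides absorbed by the
dissipation or bounded by the common bound `b` on the errors and the consistency errors. -/
lemma energy_step {ε ν δ K s₁ s₂ τ b c : ℝ} (hε : 0 < ε) (hν : 0 < ν) (hδ : 0 < δ) (hK : 0 < K)
    (hs₁ : 0 < s₁) (hs₂ : 0 < s₂) (hτ : 0 < τ)
    {e D m Le Lm P A R : H} {ge gD gm gP gA gR : V}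
    {E Ψ M LE LM P' Q A' S h k m' : B} {gE gΨ gM gQ gA' gS : W}
    (eqD : D = τ • (Lm + R)) (eqΨ : Ψ = τ • (LM - h + S))
    (eqm : m = -ε • Le + (1 / ε) • P + s₁ • (D - A))
    (eqM : M = -ν • LE + (1 / δ) • Q + ε • k + s₂ • (Ψ - A'))
    (eqK : K • h = M - m')
    (mm : ⟪h, m'⟫_ℝ = ⟪Lm, m⟫_ℝ + ⟪gm, gm⟫_ℝ) (mP : ⟪h, P'⟫_ℝ = ⟪Lm, P⟫_ℝ + ⟪gm, gP⟫_ℝ)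
    (mA : ⟪h, A'⟫_ℝ = ⟪Lm, A⟫_ℝ + ⟪gm, gA⟫_ℝ) (me : ⟪h, E⟫_ℝ = ⟪Lm, e⟫_ℝ + ⟪gm, ge⟫_ℝ)
    (eD : ⟪k, Ψ⟫_ℝ = ⟪Le, D⟫_ℝ + ⟪ge, gD⟫_ℝ) (eR : ⟪k, S⟫_ℝ = ⟪Le, R⟫_ℝ + ⟪ge, gR⟫_ℝ)
    (MM : ⟪LM, M⟫_ℝ = -⟪gM, gM⟫_ℝ) (MQ : ⟪LM, Q⟫_ℝ = -⟪gM, gQ⟫_ℝ)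
    (MA : ⟪LM, A'⟫_ℝ = -⟪gM, gA'⟫_ℝ) (ME : ⟪LM, E⟫_ℝ = -⟪gM, gE⟫_ℝ)
    (EΨ : ⟪LE, Ψ⟫_ℝ = -⟪gE, gΨ⟫_ℝ) (ES : ⟪LE, S⟫_ℝ = -⟪gE, gS⟫_ℝ)
    (be : ‖e‖ ≤ b) (bge : ‖ge‖ ≤ b) (bE : ‖E‖ ≤ b) (bgE : ‖gE‖ ≤ b) (bD : ‖D‖ ≤ b)
    (bΨ : ‖Ψ‖ ≤ b) (bgP : ‖gP‖ ≤ c * b) (bP' : ‖P'‖ ≤ c * b) (bgQ : ‖gQ‖ ≤ c * b)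
    (bQ : ‖Q‖ ≤ c * b) (bgA : ‖gA‖ ≤ c * b) (bA' : ‖A'‖ ≤ c * b) (bgA' : ‖gA'‖ ≤ c * b)
    (bR : ‖R‖ ≤ c * b) (bgR : ‖gR‖ ≤ c * b) (bS : ‖S‖ ≤ c * b) (bgS : ‖gS‖ ≤ c * b) :
    (ε * ‖ge‖ ^ 2 + ν * ‖gE‖ ^ 2 + ‖e‖ ^ 2 + ‖E‖ ^ 2) -
      (ε * ‖ge - gD‖ ^ 2 + ν * ‖gE - gΨ‖ ^ 2 + ‖e - D‖ ^ 2 + ‖E - Ψ‖ ^ 2) ≤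
      2 * τ * (stepConst ε ν δ K s₁ s₂ c * b ^ 2) := by
  have key := energy_identity eqD eqΨ eqm eqM eqK mm mP mA me eD eR MM MQ MA ME EΨ ES
  -- `q1`, `q2`, `q3` spend exactly the dissipation ‖gm‖², ‖gM‖², K‖h‖². The terms in `q4` contain
  -- no potential and are bounded directly.
  have q1 : 1 / ε * ⟪gm, gP⟫_ℝ - s₁ * ⟪gm, gA⟫_ℝ - ⟪gm, ge⟫_ℝ ≤
      ‖gm‖ ^ 2 + ((1 / ε + s₁) * c + 1) ^ 2 / 4 * b ^ 2 := by
    have y := young (a := ‖gm‖) (x := ((1 / ε + s₁) * c + 1) * b) one_pos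
    have h1 := mul_le_mul_of_nonneg_left
      (abs_le.1 (inner_le_of_norm_le (x := gm) bgP)).2 (one_div_pos.2 hε).le
    have h2 := mul_le_mul_of_nonneg_left
      (abs_le.1 (inner_le_of_norm_le (x := gm) bgA)).1 hs₁.le
    have h3 := (abs_le.1 (inner_le_of_norm_le (x := gm) bge)).1
    linarith
  have q2 : 1 / δ * ⟪gM, gQ⟫_ℝ - s₂ * ⟪gM, gA'⟫_ℝ - ⟪gM, gE⟫_ℝ ≤
      ‖gM‖ ^ 2 + ((1 / δ + s₂) * c + 1) ^ 2 / 4 * b ^ 2 := by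
    have y := young (a := ‖gM‖) (x := ((1 / δ + s₂) * c + 1) * b) one_pos
    have h1 := mul_le_mul_of_nonneg_left
      (abs_le.1 (inner_le_of_norm_le (x := gM) bgQ)).2 (one_div_pos.2 hδ).le
    have h2 := mul_le_mul_of_nonneg_left
      (abs_le.1 (inner_le_of_norm_le (x := gM) bgA')).1 hs₂.le
    have h3 := (abs_le.1 (inner_le_of_norm_le (x := gM) bgE)).1
    linarith
  have q3 : -(1 / ε) * ⟪h, P'⟫_ℝ + s₁ * ⟪h, A'⟫_ℝ + 1 / δ * ⟪h, Q⟫_ℝ - s₂ * ⟪h, A'⟫_ℝ ≤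
      K * ‖h‖ ^ 2 + ((1 / ε + s₁ + 1 / δ + s₂) * c) ^ 2 / (4 * K) * b ^ 2 := by
    have y := young (a := ‖h‖) (x := (1 / ε + s₁ + 1 / δ + s₂) * c * b) hK
    have h1 := mul_le_mul_of_nonneg_left
      (abs_le.1 (inner_le_of_norm_le (x := h) bP')).1 (one_div_pos.2 hε).le
    have h2 := mul_le_mul_of_nonneg_left
      (abs_le.1 (inner_le_of_norm_le (x := h) bA')).2 hs₁.le
    have h3 := mul_le_mul_of_nonneg_left
      (abs_le.1 (inner_le_of_norm_le (x := h) bQ)).2 (one_div_pos.2 hδ).le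
    have h4 := mul_le_mul_of_nonneg_left
      (abs_le.1 (inner_le_of_norm_le (x := h) bA')).1 hs₂.le
    have h5 : ((1 / ε + s₁ + 1 / δ + s₂) * c * b) ^ 2 / (4 * K) =
      ((1 / ε + s₁ + 1 / δ + s₂) * c) ^ 2 / (4 * K) * b ^ 2 := by ring
    linarith
  have q4 : ε * ⟪ge, gR⟫_ℝ + ν * ⟪gE, gS⟫_ℝ + s₁ * ⟪R, D⟫_ℝ + s₂ * ⟪S, Ψ⟫_ℝ
      + ⟪R, e⟫_ℝ + ⟪S, E⟫_ℝ ≤ (ε + ν + s₁ + s₂ + 2) * c * b ^ 2 := by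
    have h1 := mul_le_mul_of_nonneg_left
      (abs_le.1 (inner_le_of_norm_le_of_norm_le bge bgR)).2 hε.le
    have h2 := mul_le_mul_of_nonneg_left
      (abs_le.1 (inner_le_of_norm_le_of_norm_le bgE bgS)).2 hν.le
    have h3 := mul_le_mul_of_nonneg_left
      (abs_le.1 (inner_le_of_norm_le_of_norm_le bR bD)).2 hs₁.le
    have h4 := mul_le_mul_of_nonneg_left
      (abs_le.1 (inner_le_of_norm_le_of_norm_le bS bΨ)).2 hs₂.le
    have h5 := (abs_le.1 (inner_le_of_norm_le_of_norm_le bR be)).2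
    have h6 := (abs_le.1 (inner_le_of_norm_le_of_norm_le bS bE)).2
    linarith
  have g1 := mul_le_mul_of_nonneg_left (sq_sub_sq_le_inner ge gD) hε.le
  have g2 := mul_le_mul_of_nonneg_left (sq_sub_sq_le_inner gE gΨ) hν.le
  have g3 := sq_sub_sq_le_inner e D
  have g4 := sq_sub_sq_le_inner E Ψ
  -- The stabilization terms in the error increments have the good sign and are discarded.
  have g5 : 0 ≤ s₁ * ‖D‖ ^ 2 := by positivity
  have g6 : 0 ≤ s₂ * ‖Ψ‖ ^ 2 := by positivity
  have q := mul_le_mul_of_nonneg_left (add_le_add (add_le_add (add_le_add q1 q2) q3) q4) hτ.le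
  unfold stepConst
  linarith

end EnergyStep

/-! ### Discrete Gronwall inequality. -/

/-- A discrete Gronwall inequality. -/
lemma discrete_gronwall {C τ : ℝ} {N : ℕ} {Z : ℕ → ℝ} (hC : 0 ≤ C) (hτ : 0 < τ)
    (hCτ : C * τ ≤ 1 / 2) (hZ : ∀ n, 0 ≤ Z n) (h0 : Z 0 = 0)
    (hstep : ∀ n < N, Z (n + 1) - Z n ≤ τ * C * (Z (n + 1) + Z n + τ ^ 2)) {n : ℕ} (hn : n ≤ N) :
    Z n ≤ Real.exp (4 * C * (n * τ)) * τ ^ 2 := by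
  have hx : 0 ≤ C * τ := by positivity
  -- Adding τ² makes the recursion homogeneous. With x = Cτ ≤ 1/2, the growth factor 1 + 4x is
  -- enough because (1 − x)(1 + 4x) − (1 + x) = 2x(1 − 2x) ≥ 0.
  have key : ∀ n ≤ N, Z n + τ ^ 2 ≤ (1 + 4 * (C * τ)) ^ n * τ ^ 2 := by
    intro n
    induction n with
    | zero => intro _; simp [h0]
    | succ n ih =>
      intro hn
      have h1 := ih (by omega)
      have h2 := hstep n (by omega)
      have h3 : (1 - C * τ) * (Z (n + 1) + τ ^ 2) ≤
          (1 - C * τ) * ((1 + 4 * (C * τ)) * (Z n + τ ^ 2)) := by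
        have h4 : 0 ≤ 2 * (C * τ) * (1 - 2 * (C * τ)) * (Z n + τ ^ 2) :=
          mul_nonneg (mul_nonneg (by positivity) (by linarith))
            (add_nonneg (hZ n) (sq_nonneg τ))
        have h5 : 0 ≤ C * τ * τ ^ 2 := by positivity
        linarith
      have h6 := le_of_mul_le_mul_left h3 (by linarith)
      calc Z (n + 1) + τ ^ 2 ≤ (1 + 4 * (C * τ)) * (Z n + τ ^ 2) := h6
        _ ≤ (1 + 4 * (C * τ)) * ((1 + 4 * (C * τ)) ^ n * τ ^ 2) := by gcongr
        _ = _ := by ring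
  have h1 := key n hn
  have h2 : (1 + 4 * (C * τ)) ^ n ≤ Real.exp (4 * C * (n * τ)) := by
    have : 4 * C * (n * τ) = n * (4 * (C * τ)) := by ring
    rw [this, Real.exp_nat_mul]
    gcongr
    linarith [Real.add_one_le_exp (4 * (C * τ))]
  have h3 := mul_le_mul_of_nonneg_right h2 (sq_nonneg τ)
  linarith [sq_nonneg τ]

/-! ### Consistency of the backward difference quotient. -/

section Consistency

variable {X : Type*} [NormedAddCommGroup X] [NormedSpace ℝ X] {T : ℝ} {u : ℝ → X}

/-- The derivative is taken at the right endpoint, as in implicit Euler. Lipschitz continuity of the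
derivative replaces a second derivative; with the value at 0 it also bounds the derivative on [0,T].
-/
lemma IsW2Infty.exists_bound (hT : 0 < T) (hu : IsW2Infty T u) :
    ∃ c : ℝ, 0 ≤ c ∧ ∀ t s, 0 ≤ t → t < s → s ≤ T → ‖u s - u t‖ ≤ c * (s - t) ∧
      ‖(1 / (s - t)) • (u s - u t) - derivWithin u (Icc 0 T) s‖ ≤ c * (s - t) := by
  obtain ⟨hd, L, hL⟩ := hu
  have h0 : (0 : ℝ) ∈ Icc 0 T := ⟨le_rfl, hT.le⟩
  refine ⟨‖derivWithin u (Icc 0 T) 0‖ + L * T + L, by positivity, fun t s ht hts hs => ?_⟩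
  have hst : 0 < s - t := sub_pos.2 hts
  have hsI : s ∈ Icc 0 T := ⟨ht.trans hts.le, hs⟩
  have htI : t ∈ Icc 0 T := ⟨ht, hts.le.trans hs⟩
  constructor
  · have hb : ∀ x ∈ Icc 0 T, ‖derivWithin u (Icc 0 T) x‖ ≤
        ‖derivWithin u (Icc 0 T) 0‖ + L * T := fun x hx => by
      have h1 := hL.norm_sub_le hx h0
      rw [sub_zero, Real.norm_eq_abs, abs_of_nonneg hx.1] at h1
      have h2 := norm_le_insert' (derivWithin u (Icc 0 T) x) (derivWithin u (Icc 0 T) 0)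
      have h3 : (L : ℝ) * x ≤ L * T := mul_le_mul_of_nonneg_left hx.2 L.2
      linarith
    have h1 := (convex_Icc 0 T).norm_image_sub_le_of_norm_derivWithin_le hd hb htI hsI
    rw [Real.norm_eq_abs, abs_of_pos hst] at h1
    have : 0 ≤ (L : ℝ) * (s - t) := by positivity
    linarith
  · have hsub : Icc t s ⊆ Icc 0 T := Icc_subset_Icc ht hs
    -- Mean value inequality for u(x) − x u'(s), whose derivative u'(x) − u'(s) is at most L(s − t)
    -- in norm.
    have hder : ∀ x ∈ Icc t s, HasDerivWithinAt
        (fun x => u x - x • derivWithin u (Icc 0 T) s)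
        (derivWithin u (Icc 0 T) x - derivWithin u (Icc 0 T) s) (Icc t s) x := fun x hx => by
      have h1 := ((hd x (hsub hx)).hasDerivWithinAt).mono hsub
      simpa using h1.fun_sub ((hasDerivWithinAt_id x _).smul_const (derivWithin u (Icc 0 T) s))
    have hb : ∀ x ∈ Icc t s, ‖derivWithin u (Icc 0 T) x - derivWithin u (Icc 0 T) s‖ ≤
        L * (s - t) := fun x hx => by
      refine (hL.norm_sub_le (hsub hx) hsI).trans ?_
      rw [Real.norm_eq_abs, abs_sub_comm, abs_of_nonneg (sub_nonneg.2 hx.2)]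
      exact mul_le_mul_of_nonneg_left (by linarith [hx.1]) L.2
    have h1 := (convex_Icc t s).norm_image_sub_le_of_norm_hasDerivWithin_le hder hb
      (left_mem_Icc.2 hts.le) (right_mem_Icc.2 hts.le)
    have h2 : (1 / (s - t)) • (u s - u t) - derivWithin u (Icc 0 T) s = (1 / (s - t)) •
        ((u s - s • derivWithin u (Icc 0 T) s) - (u t - t • derivWithin u (Icc 0 T) s)) := by
      have : derivWithin u (Icc 0 T) s =
          (1 / (s - t)) • ((s - t) • derivWithin u (Icc 0 T) s) := by
        rw [smul_smul, one_div_mul_cancel hst.ne', one_smul]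
      nth_rewrite 1 [this]
      module
    rw [Real.norm_eq_abs, abs_of_pos hst] at h1
    rw [h2, norm_smul, Real.norm_eq_abs, abs_of_pos (one_div_pos.2 hst)]
    calc 1 / (s - t) * _ ≤ 1 / (s - t) * (L * (s - t) * (s - t)) := by gcongr
      _ = L * (s - t) := by field_simp
      _ ≤ _ := by
        have : 0 ≤ ‖derivWithin u (Icc 0 T) 0‖ + L * T := by positivity
        gcongr
        linarith

end Consistency

/-! ### Norms of pairs consisting of a function and its gradient. -/

section Pairs

variable {A B : Type*} [NormedAddCommGroup A] [NormedSpace ℝ A] [NormedAddCommGroup B]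
  [NormedSpace ℝ B] {S : Submodule ℝ (WithLp 2 (A × B))}

lemma fn_sub (u v : S) : fn (u - v) = fn u - fn v := rfl

lemma fn_smul (c : ℝ) (u : S) : fn (c • u) = c • fn u := rfl

lemma grad_sub (u v : S) : grad (u - v) = grad u - grad v := rfl

lemma continuous_fn : Continuous (fn : S → A) := by unfold fn; fun_prop

lemma continuous_grad : Continuous (grad : S → B) := by unfold grad; fun_prop

lemma norm_sq_eq (u : S) : ‖u‖ ^ 2 = ‖fn u‖ ^ 2 + ‖grad u‖ ^ 2 :=
  WithLp.prod_norm_sq_eq_of_L2 u.1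

lemma norm_fn_le (u : S) : ‖fn u‖ ≤ ‖u‖ := by
  have := norm_sq_eq u
  exact le_of_sq_le_sq (by nlinarith [sq_nonneg ‖grad u‖]) (norm_nonneg _)

lemma norm_grad_le (u : S) : ‖grad u‖ ≤ ‖u‖ := by
  have := norm_sq_eq u
  exact le_of_sq_le_sq (by nlinarith [sq_nonneg ‖fn u‖]) (norm_nonneg _)

end Pairs

/-! ### Differences of nonlinear terms, and the equations as identities in L². -/

section Nonlinear

variable {X E : Type*} [MeasurableSpace X] {ν : Measure X} [NormedAddCommGroup E]
  [InnerProductSpace ℝ E]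

/-- Lipschitz estimate for `(u, g) ↦ q(u) g` at a bounded `g`. -/
lemma BddCont.norm_smulComp_sub_le {q : ℝ → ℝ} {L κ M : ℝ} (hq : BddCont q L)
    (hκ : ∀ x y, |q x - q y| ≤ κ * |x - y|) (hκ0 : 0 ≤ κ) (u u₀ : Lp ℝ 2 ν)
    (g g₀ : Lp E 2 ν) (hM : ∀ᵐ x ∂ν, ‖g x‖ ≤ M) :
    ‖hq.smulComp u g - hq.smulComp u₀ g₀‖ ≤ κ * M * ‖u - u₀‖ + L * ‖g - g₀‖ := by
  -- The splitting puts the bounded g next to the difference of the q-values, so g₀ needs no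
  -- pointwise bound.
  have h1 : hq.smulComp u g - hq.smulComp u₀ g₀ =
      (hq.smulComp u g - hq.smulComp u₀ g) + hq.smulComp u₀ (g - g₀) := by
    rw [hq.smulComp_sub]; abel
  rw [h1]
  refine (norm_add_le _ _).trans (add_le_add ?_ (hq.norm_smulComp_le _ _))
  refine Lp.norm_le_mul_norm_of_ae_le_mul ?_
  filter_upwards [hq.coeFn_smulComp u g, hq.coeFn_smulComp u₀ g, hM, Lp.coeFn_sub u u₀,
    Lp.coeFn_sub (hq.smulComp u g) (hq.smulComp u₀ g)] with x e1 e2 e3 e4 e5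
  rw [e5, Pi.sub_apply, e1, e2, e4, Pi.sub_apply, ← sub_smul, norm_smul, Real.norm_eq_abs,
    Real.norm_eq_abs]
  calc |q (u x) - q (u₀ x)| * ‖g x‖ ≤ (κ * |u x - u₀ x|) * M :=
        mul_le_mul (hκ _ _) e3 (norm_nonneg _) (by positivity)
    _ = _ := by ring

/-- Subtraction of the equations for the exact and the discrete chemical potential. -/
lemma potential_sub {f p : ℝ → ℝ} {L : ℝ≥0} {a c r s k : ℝ} (hp : ChainFun p L)
    (hf : ∀ x, f x = p x + k) {m m₁ l l₁ n n₁ u u₀ u₁ : Lp ℝ 2 ν}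
    (h : ∀ᵐ x ∂ν, m x = -a * l x + c * f (u x) + r * n x)
    (h₁ : ∀ᵐ x ∂ν, m₁ x = -a * l₁ x + c * f (u₀ x) + r * n₁ x + s * (u₁ x - u₀ x)) :
    m - m₁ = -a • (l - l₁) + c • (hp.lipschitz.compLp hp.zero u - hp.lipschitz.compLp hp.zero u₀)
      + r • (n - n₁) - s • (u₁ - u₀) := by
  refine Lp.ext ?_
  set P := hp.lipschitz.compLp hp.zero u
  set P₀ := hp.lipschitz.compLp hp.zero u₀
  have e1 : ∀ᵐ x ∂ν, P x = p (u x) := hp.lipschitz.coeFn_compLp hp.zero u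
  have e2 : ∀ᵐ x ∂ν, P₀ x = p (u₀ x) := hp.lipschitz.coeFn_compLp hp.zero u₀
  filter_upwards [h, h₁, e1, e2, Lp.coeFn_sub m m₁, Lp.coeFn_sub l l₁, Lp.coeFn_sub P P₀,
    Lp.coeFn_sub n n₁, Lp.coeFn_sub u₁ u₀, Lp.coeFn_smul (-a) (l - l₁),
    Lp.coeFn_smul c (P - P₀), Lp.coeFn_smul r (n - n₁), Lp.coeFn_smul s (u₁ - u₀),
    Lp.coeFn_add (-a • (l - l₁)) (c • (P - P₀)),
    Lp.coeFn_add (-a • (l - l₁) + c • (P - P₀)) (r • (n - n₁)),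
    Lp.coeFn_sub (-a • (l - l₁) + c • (P - P₀) + r • (n - n₁)) (s • (u₁ - u₀))]
    with x a1 a2 a3 a4 a5 a6 a7 a8 a9 b1 b2 b3 b4 b5 b6 b7
  rw [a5, b7]
  simp only [Pi.sub_apply, Pi.add_apply, Pi.smul_apply, smul_eq_mul, b6, b5, b4, b3, b2, b1, a9,
    a8, a7, a6, a4, a3, a2, a1, hf]
  ring

lemma eq_smul_of_ae {τ : ℝ} (hτ : τ ≠ 0) {u u₀ f : Lp ℝ 2 ν}
    (h : ∀ᵐ x ∂ν, (u x - u₀ x) / τ = f x) : u - u₀ = τ • f := by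
  refine Lp.ext ?_
  filter_upwards [h, Lp.coeFn_sub u u₀, Lp.coeFn_smul τ f] with x h1 h2 h3
  rw [h2, h3, Pi.sub_apply, Pi.smul_apply, smul_eq_mul, ← h1]
  field_simp

lemma eq_sub_of_ae {u f g : Lp ℝ 2 ν} (h : ∀ᵐ x ∂ν, u x = f x - g x) : u = f - g := by
  refine Lp.ext ?_
  filter_upwards [h, Lp.coeFn_sub f g] with x h1 h2
  rw [h1, h2, Pi.sub_apply]

lemma smul_eq_sub_of_ae {K : ℝ} {u f g : Lp ℝ 2 ν} (h : ∀ᵐ x ∂ν, K * u x = f x - g x) :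
    K • u = f - g := by
  refine eq_sub_of_ae ?_
  filter_upwards [h, Lp.coeFn_smul K u] with x h1 h2
  rw [h2, Pi.smul_apply, smul_eq_mul, h1]

end Nonlinear

/-! ### Compatible bulk and surface functions. -/

section Compatibility

variable {d : ℕ} {Ω : Set (EuclideanSpace ℝ (Fin d))}

/-- The pairs `(u, v)` of functions in `H¹(Ω)` and `H¹(Γ)` which are compatible in the sense that
Green's formula holds for `u` with boundary values `v`. -/
def compatible (Ω : Set (EuclideanSpace ℝ (Fin d))) : Submodule ℝ (H1Bulk Ω × H1Surf Ω) where
  carrier := {z | (fn z.1, grad z.1, fn z.2) ∈ bulkTest Ω}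
  zero_mem' := (bulkTest Ω).zero_mem
  add_mem' := fun ha hb => (bulkTest Ω).add_mem ha hb
  smul_mem' := fun c _ ha => (bulkTest Ω).smul_mem c ha

lemma isClosed_compatible : IsClosed (SetLike.coe (compatible Ω)) := by
  have : Continuous fun z : H1Bulk Ω × H1Surf Ω => (fn z.1, grad z.1, fn z.2) :=
    (continuous_fn.comp continuous_fst).prodMk
      ((continuous_grad.comp continuous_fst).prodMk (continuous_fn.comp continuous_snd))
  exact isClosed_bulkTest.preimage this

/-- A derivative lies in the closed span of the values of the curve, and `compatible Ω` is a closed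
subspace. -/
lemma derivWithin_mem_compatible {T : ℝ} (hT : 0 < T) {φ : ℝ → H1Bulk Ω} {ψ : ℝ → H1Surf Ω}
    (hφ : DifferentiableOn ℝ φ (Icc 0 T)) (hψ : DifferentiableOn ℝ ψ (Icc 0 T))
    (h : ∀ t ∈ Icc 0 T, (φ t, ψ t) ∈ compatible Ω) {t : ℝ} (ht : t ∈ Icc 0 T) :
    (derivWithin φ (Icc 0 T) t, derivWithin ψ (Icc 0 T) t) ∈ compatible Ω := by
  have h1 : derivWithin (fun s => (φ s, ψ s)) (Icc 0 T) t =
      (derivWithin φ (Icc 0 T) t, derivWithin ψ (Icc 0 T) t) :=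
    ((hφ t ht).hasDerivWithinAt.prodMk (hψ t ht).hasDerivWithinAt).derivWithin
      (uniqueDiffOn_Icc hT t ht)
  rw [← h1]
  have h2 := range_derivWithin_subset_closure_span_image (fun s => (φ s, ψ s))
    (s := Icc 0 T) (t := Icc 0 T) (by rw [inter_self]; exact subset_closure) (mem_range_self t)
  refine closure_minimal ?_ isClosed_compatible h2
  refine SetLike.coe_subset_coe.2 (Submodule.span_le.2 ?_)
  rintro _ ⟨s, hs, rfl⟩
  exact h s hs

/-- The system is posed for t > 0 only; the initial data inherit the trace relation because the
trace graph is closed. -/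
lemma hasTrace_of_forall_Ioc {T : ℝ} (hT : 0 < T) {φ : ℝ → H1Bulk Ω} {ψ : ℝ → H1Surf Ω}
    (hφ : ContinuousOn φ (Icc 0 T)) (hψ : ContinuousOn ψ (Icc 0 T))
    (h : ∀ t ∈ Ioc 0 T, HasTrace (φ t) (fn (ψ t))) {t : ℝ} (ht : t ∈ Icc 0 T) :
    HasTrace (φ t) (fn (ψ t)) := by
  have hc : ContinuousOn (fun t => (φ t, fn (ψ t))) (closure (Ioc 0 T)) := by
    rw [closure_Ioc hT.ne]
    exact hφ.prodMk (continuous_fn.comp_continuousOn hψ)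
  have hm := MapsTo.closure_of_continuousOn (fun t ht => h t ht) hc
  rw [closure_Ioc hT.ne] at hm
  simpa [HasTrace] using hm ht

lemma green_sub {u u' : H1Bulk Ω} {f f' : L2Bulk Ω} {h h' : L2Surf Ω} (hl : IsLaplacian u f)
    (hl' : IsLaplacian u' f') (hn : IsNormalDeriv u h) (hn' : IsNormalDeriv u' h')
    {a : L2Bulk Ω} {b : Lp (EuclideanSpace ℝ (Fin d)) 2 (bulkMeasure Ω)} {c : L2Surf Ω}
    (ht : (a, b, c) ∈ bulkTest Ω) :
    ⟪h - h', c⟫_ℝ = ⟪f - f', a⟫_ℝ + ⟪grad (u - u'), b⟫_ℝ := by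
  have h1 : ⟪h, c⟫_ℝ = ⟪f, a⟫_ℝ + ⟪grad u, b⟫_ℝ := ht u f h hl hn
  have h2 : ⟪h', c⟫_ℝ = ⟪f', a⟫_ℝ + ⟪grad u', b⟫_ℝ := ht u' f' h' hl' hn'
  rw [grad_sub, inner_sub_left, inner_sub_left, inner_sub_left]
  linarith

lemma surf_green_sub {u u' : H1Surf Ω} {f f' : L2Surf Ω} (hl : IsSurfLaplacian u f)
    (hl' : IsSurfLaplacian u' f') {a : L2Surf Ω}
    {b : Lp (EuclideanSpace ℝ (Fin d)) 2 (surfaceMeasure Ω)} (ht : (a, b) ∈ surfTest Ω) :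
    ⟪f - f', a⟫_ℝ = -⟪grad (u - u'), b⟫_ℝ := by
  have h1 : ⟪f, a⟫_ℝ = -⟪grad u, b⟫_ℝ := ht u f hl
  have h2 : ⟪f', a⟫_ℝ = -⟪grad u', b⟫_ℝ := ht u' f' hl'
  rw [grad_sub, inner_sub_left, inner_sub_left]
  linarith

end Compatibility

/-! ### The energy of the errors over one time step. -/

section Error

variable {d : ℕ} {Ω : Set (EuclideanSpace ℝ (Fin d))}

/-- The energy of a pair of errors. -/
noncomputable def energy (ε ν : ℝ) (u : H1Bulk Ω) (v : H1Surf Ω) : ℝ :=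
  ε * ‖grad u‖ ^ 2 + ν * ‖grad v‖ ^ 2 + ‖fn u‖ ^ 2 + ‖fn v‖ ^ 2

/-- Having the L² norms in the energy gives control of the full H¹ norms without a Poincaré
inequality. -/
lemma min_mul_norm_sq_le_energy {ε ν : ℝ} (u : H1Bulk Ω) (v : H1Surf Ω) :
    min 1 (min ε ν) * (‖u‖ ^ 2 + ‖v‖ ^ 2) ≤ energy ε ν u v := by
  have h1 : min 1 (min ε ν) ≤ 1 := min_le_left _ _
  have h2 : min 1 (min ε ν) ≤ ε := (min_le_right _ _).trans (min_le_left _ _)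
  have h3 : min 1 (min ε ν) ≤ ν := (min_le_right _ _).trans (min_le_right _ _)
  have e1 := mul_le_mul_of_nonneg_right h1 (sq_nonneg ‖fn u‖)
  have e2 := mul_le_mul_of_nonneg_right h1 (sq_nonneg ‖fn v‖)
  have e3 := mul_le_mul_of_nonneg_right h2 (sq_nonneg ‖grad u‖)
  have e4 := mul_le_mul_of_nonneg_right h3 (sq_nonneg ‖grad v‖)
  rw [norm_sq_eq u, norm_sq_eq v, energy]
  linarith

lemma sub_mem_compatible {u u' : H1Bulk Ω} {v v' : H1Surf Ω} (h : (u, v) ∈ compatible Ω)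
    (h' : (u', v') ∈ compatible Ω) : (u - u', v - v') ∈ compatible Ω :=
  Prod.mk_sub_mk u u' v v' ▸ (compatible Ω).sub_mem h h'

lemma smul_mem_compatible {u : H1Bulk Ω} {v : H1Surf Ω} (c : ℝ) (h : (u, v) ∈ compatible Ω) :
    (c • u, c • v) ∈ compatible Ω :=
  Prod.smul_mk c u v ▸ (compatible Ω).smul_mem c h

lemma HasTrace.mem_compatible (hΩ : IsOpen Ω) {u : H1Bulk Ω} {v : H1Surf Ω}
    (h : HasTrace u (fn v)) : (u, v) ∈ compatible Ω :=
  h.mem_bulkTest hΩ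

lemma HasTrace.sub_mem_bulkTest (hΩ : IsOpen Ω) {u u' : H1Bulk Ω} {g g' : L2Surf Ω}
    (h : HasTrace u g) (h' : HasTrace u' g') :
    (fn (u - u'), grad (u - u'), g - g') ∈ bulkTest Ω :=
  (bulkTest Ω).sub_mem (h.mem_bulkTest hΩ) (h'.mem_bulkTest hΩ)

lemma HasTrace.comp_sub_mem_bulkTest (hΩ : IsOpen Ω) {p : ℝ → ℝ} {L : ℝ≥0} (hp : ChainFun p L)
    {u u' : H1Bulk Ω} {g g' : L2Surf Ω} (h : HasTrace u g) (h' : HasTrace u' g') :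
    (hp.lipschitz.compLp hp.zero (fn u) - hp.lipschitz.compLp hp.zero (fn u'),
      hp.bddCont.smulComp (fn u) (grad u) - hp.bddCont.smulComp (fn u') (grad u'),
      hp.lipschitz.compLp hp.zero g - hp.lipschitz.compLp hp.zero g') ∈ bulkTest Ω :=
  (bulkTest Ω).sub_mem (h.comp_mem_bulkTest hΩ hp) (h'.comp_mem_bulkTest hΩ hp)

lemma comp_sub_mem_surfTest {p : ℝ → ℝ} {L : ℝ≥0} (hp : ChainFun p L) (v v' : H1Surf Ω) :
    (hp.lipschitz.compLp hp.zero (fn v) - hp.lipschitz.compLp hp.zero (fn v'),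
      hp.bddCont.smulComp (fn v) (grad v) - hp.bddCont.smulComp (fn v') (grad v')) ∈
      surfTest Ω :=
  (surfTest Ω).sub_mem (comp_mem_surfTest hp v) (comp_mem_surfTest hp v')

set_option maxHeartbeats 1000000 in
/-- The energy estimate for one step of the scheme. -/
lemma energy_sub_energy_le (hΩ : IsOpen Ω) {ε δ κ K s₁ s₂ τ q M c₀ kF kG : ℝ} (hε : 0 < ε)
    (hδ : 0 < δ) (hκ : 0 < κ) (hK : 0 < K) (hs₁ : 0 < s₁) (hs₂ : 0 < s₂) (hτ : 0 < τ)
    (hq0 : 0 ≤ q) (hM0 : 0 ≤ M) (hc₀ : 0 ≤ c₀) {F G pF pG : ℝ → ℝ} {L : ℝ≥0}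
    (hpF : ChainFun pF L) (hpG : ChainFun pG L)
    (hF : ∀ x, deriv F x = pF x + kF) (hG : ∀ x, deriv G x = pG x + kG)
    (hqF : ∀ x y, |deriv pF x - deriv pF y| ≤ q * |x - y|)
    (hqG : ∀ x y, |deriv pG x - deriv pG y| ≤ q * |x - y|)
    {φ μ φt φp φ₀ φ₁ μ₁ : H1Bulk Ω} {ψ μΓ ψt ψp ψ₀ ψ₁ μΓ₁ : H1Surf Ω}
    (hex : KLLMSystem Ω F G ε δ κ K φ μ ψ μΓ φt ψt)
    (hsc : SchemeStep Ω F G ε δ κ K s₁ s₂ τ φ₀ ψ₀ φ₁ μ₁ ψ₁ μΓ₁)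
    (hp : (φp, ψp) ∈ compatible Ω) (ht : (φt, ψt) ∈ compatible Ω) (h₀ : HasTrace φ₀ (fn ψ₀))
    (bA : ‖φ - φp‖ ≤ c₀ * τ) (bA' : ‖ψ - ψp‖ ≤ c₀ * τ)
    (bR : ‖(1 / τ) • (φ - φp) - φt‖ ≤ c₀ * τ) (bS : ‖(1 / τ) • (ψ - ψp) - ψt‖ ≤ c₀ * τ)
    (hMφ : ∀ᵐ x ∂(bulkMeasure Ω), ‖grad φ x‖ ≤ M)
    (hMψ : ∀ᵐ x ∂(surfaceMeasure Ω), ‖grad ψ x‖ ≤ M) :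
    energy ε (δ * κ) (φ - φ₁) (ψ - ψ₁) - energy ε (δ * κ) (φp - φ₀) (ψp - ψ₀) ≤
      2 * τ * (stepConst ε (δ * κ) δ K s₁ s₂ ((q * M + L + 1) * (c₀ + 1)) *
        (‖φ - φ₁‖ + ‖φp - φ₀‖ + ‖ψ - ψ₁‖ + ‖ψp - ψ₀‖ + τ) ^ 2) := by
  obtain ⟨Δφ, Δμ, Δψ, ΔμΓ, dnφ, dnμ, trμ, l1, l2, l3, l4, n1, n2, t1, x1, x2, x3, t2, x4, x5⟩ := hex
  obtain ⟨Δφ₁, Δμ₁, Δψ₁, ΔμΓ₁, dnφ₁, dnμ₁, trμ₁, l1', l2', l3', l4', n1', n2', t1', x1', x2', x3',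
    t2', x4', x5'⟩ := hsc
  -- Every term is bounded by a multiple of b, the sum of the new errors, the old errors and τ. The
  -- explicit nonlinearity compares the new exact value with the old discrete one, at distance at
  -- most (c₀ + 1) b; its Lipschitz bound contributes q M + L, and the extra 1 covers the
  -- consistency errors c₀ τ.
  set b := ‖φ - φ₁‖ + ‖φp - φ₀‖ + ‖ψ - ψ₁‖ + ‖ψp - ψ₀‖ + τ with hb
  have z1 : 0 ≤ ‖φ - φ₁‖ := norm_nonneg _
  have z2 : 0 ≤ ‖φp - φ₀‖ := norm_nonneg _
  have z3 : 0 ≤ ‖ψ - ψ₁‖ := norm_nonneg _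
  have z4 : 0 ≤ ‖ψp - ψ₀‖ := norm_nonneg _
  have hb0 : 0 ≤ b := by positivity
  have hL0 : (0 : ℝ) ≤ L := L.2
  have hqM : 0 ≤ q * M := mul_nonneg hq0 hM0
  have hc : c₀ * τ ≤ (q * M + L + 1) * (c₀ + 1) * b := by
    have h1 : c₀ * τ ≤ c₀ * b := mul_le_mul_of_nonneg_left (by linarith) hc₀
    have h2 : 0 ≤ b + (q * M + L) * (c₀ + 1) * b := by positivity
    linarith
  have hd : ‖φ - φ₀‖ ≤ (c₀ + 1) * b := by
    have h1 : ‖φ - φ₀‖ ≤ ‖φ - φp‖ + ‖φp - φ₀‖ := norm_sub_le_norm_sub_add_norm_sub _ _ _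
    have h2 : c₀ * τ ≤ c₀ * b := mul_le_mul_of_nonneg_left (by linarith) hc₀
    linarith
  have hd' : ‖ψ - ψ₀‖ ≤ (c₀ + 1) * b := by
    have h1 : ‖ψ - ψ₀‖ ≤ ‖ψ - ψp‖ + ‖ψp - ψ₀‖ := norm_sub_le_norm_sub_add_norm_sub _ _ _
    have h2 : c₀ * τ ≤ c₀ * b := mul_le_mul_of_nonneg_left (by linarith) hc₀
    linarith
  have hP0 : 0 ≤ (c₀ + 1) * b := by positivity
  have bgrad : ∀ x y : ℝ, x ≤ (c₀ + 1) * b → y ≤ (c₀ + 1) * b →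
      q * M * x + L * y ≤ (q * M + L + 1) * (c₀ + 1) * b := fun x y hx hy => by
    have h1 := mul_le_mul_of_nonneg_left hx hqM
    have h2 := mul_le_mul_of_nonneg_left hy hL0
    linarith
  have bfun : ∀ x : ℝ, x ≤ (c₀ + 1) * b → L * x ≤ (q * M + L + 1) * (c₀ + 1) * b :=
    fun x hx => by
    have h1 := mul_le_mul_of_nonneg_left hx hL0
    have h2 := mul_nonneg hqM hP0
    linarith
  -- compatible pairs and test functions
  have cφ := t2.mem_compatible hΩ
  have ce := sub_mem_compatible cφ (t2'.mem_compatible hΩ)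
  have ce₀ := sub_mem_compatible hp (h₀.mem_compatible hΩ)
  have cD := sub_mem_compatible ce ce₀
  have cA := sub_mem_compatible cφ hp
  have cR := sub_mem_compatible (smul_mem_compatible (1 / τ) cA) ht
  have tm := t1.sub_mem_bulkTest hΩ t1'
  have tP := t2.comp_sub_mem_bulkTest hΩ hpF h₀
  have tQ := comp_sub_mem_surfTest hpG ψ ψ₀
  -- the error equations
  have hone : τ * (1 / τ) = 1 := mul_one_div_cancel hτ.ne'
  have y1 : fn φt = Δμ := Lp.ext x1
  have y1' := eq_smul_of_ae hτ.ne' x1'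
  have y2 := eq_sub_of_ae x4
  have y2' := eq_smul_of_ae (f := ΔμΓ₁ - dnμ₁) hτ.ne' (by
    filter_upwards [x4', Lp.coeFn_sub ΔμΓ₁ dnμ₁] with x h1 h2
    rw [h1, h2, Pi.sub_apply])
  -- The bulk potential has no flux term, hence r = 0 with arbitrary n and n₁.
  have y3 := potential_sub (a := ε) (c := 1 / ε) (r := 0) (n := Δφ) (n₁ := Δφ) hpF hF
    (by simpa using x2) (by simpa using x2')
  have y4 := potential_sub hpG hG x5 x5'
  have y5 := smul_eq_sub_of_ae x3
  have y5' := smul_eq_sub_of_ae x3'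
  have key := energy_step (b := b) (c := (q * M + L + 1) * (c₀ + 1)) (τ := τ) (K := K) hε
    (mul_pos hδ hκ) hδ hK hs₁ hs₂ hτ
    (e := fn (φ - φ₁)) (D := fn (φ - φ₁ - (φp - φ₀))) (m := fn (μ - μ₁)) (Le := Δφ - Δφ₁)
    (Lm := Δμ - Δμ₁) (A := fn (φ - φp)) (R := fn ((1 / τ) • (φ - φp) - φt))
    (E := fn (ψ - ψ₁)) (Ψ := fn (ψ - ψ₁ - (ψp - ψ₀))) (M := fn (μΓ - μΓ₁)) (LE := Δψ - Δψ₁)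
    (LM := ΔμΓ - ΔμΓ₁) (A' := fn (ψ - ψp)) (S := fn ((1 / τ) • (ψ - ψp) - ψt))
    (h := dnμ - dnμ₁) (k := dnφ - dnφ₁)
    (by
      have h1 : fn φ₁ = fn φ₀ + τ • Δμ₁ := by rw [← y1']; abel
      simp only [fn_sub, fn_smul, y1, h1, smul_add, smul_sub, smul_smul, hone, one_smul]
      abel)
    (by
      have h1 : fn ψ₁ = fn ψ₀ + τ • (ΔμΓ₁ - dnμ₁) := by rw [← y2']; abel
      simp only [fn_sub, fn_smul, y2, h1, smul_add, smul_sub, smul_smul, hone, one_smul]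
      abel)
    (by
      rw [fn_sub μ μ₁, y3]
      simp only [fn_sub, zero_smul, add_zero]
      module)
    (by
      rw [fn_sub μΓ μΓ₁, y4]
      simp only [fn_sub]
      module)
    (by
      rw [smul_sub, y5, y5', fn_sub]
      abel)
    (green_sub l2 l2' n2 n2' tm) (green_sub l2 l2' n2 n2' tP) (green_sub l2 l2' n2 n2' cA)
    (green_sub l2 l2' n2 n2' ce) (green_sub l1 l1' n1 n1' cD) (green_sub l1 l1' n1 n1' cR)
    (surf_green_sub l4 l4' (mem_surfTest _)) (surf_green_sub l4 l4' tQ)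
    (surf_green_sub l4 l4' (mem_surfTest _)) (surf_green_sub l4 l4' (mem_surfTest _))
    (surf_green_sub l3 l3' (mem_surfTest _)) (surf_green_sub l3 l3' (mem_surfTest _))
    ((norm_fn_le _).trans (by linarith)) ((norm_grad_le _).trans (by linarith))
    ((norm_fn_le _).trans (by linarith)) ((norm_grad_le _).trans (by linarith))
    ((norm_fn_le _).trans ((norm_sub_le _ _).trans (by linarith)))
    ((norm_fn_le _).trans ((norm_sub_le _ _).trans (by linarith)))
    ((hpF.bddCont.norm_smulComp_sub_le hqF hq0 _ _ _ _ hMφ).trans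
      (bgrad _ _ ((norm_fn_le (φ - φ₀)).trans hd) ((norm_grad_le (φ - φ₀)).trans hd)))
    ((hpF.lipschitz.norm_compLp_sub_le hpF.zero _ _).trans
      (bfun _ ((norm_fn_le (ψ - ψ₀)).trans hd')))
    ((hpG.bddCont.norm_smulComp_sub_le hqG hq0 _ _ _ _ hMψ).trans
      (bgrad _ _ ((norm_fn_le (ψ - ψ₀)).trans hd') ((norm_grad_le (ψ - ψ₀)).trans hd')))
    ((hpG.lipschitz.norm_compLp_sub_le hpG.zero _ _).trans
      (bfun _ ((norm_fn_le (ψ - ψ₀)).trans hd')))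
    ((norm_grad_le _).trans (bA.trans hc)) ((norm_fn_le _).trans (bA'.trans hc))
    ((norm_grad_le _).trans (bA'.trans hc)) ((norm_fn_le _).trans (bR.trans hc))
    ((norm_grad_le _).trans (bR.trans hc)) ((norm_fn_le _).trans (bS.trans hc))
    ((norm_grad_le _).trans (bS.trans hc))
  -- New error minus its increment is the old error, so the subtracted squares are the old energy.
  rw [← fn_sub, ← fn_sub, ← grad_sub, ← grad_sub, sub_sub_cancel, sub_sub_cancel] at key
  exact key

end Error

/-! ### From the one-step estimate to first-order convergence. -/

lemma stepConst_nonneg {ε ν δ K s₁ s₂ c : ℝ} (hε : 0 < ε) (hν : 0 < ν) (hK : 0 < K)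
    (hs₁ : 0 < s₁) (hs₂ : 0 < s₂) (hc : 0 ≤ c) : 0 ≤ stepConst ε ν δ K s₁ s₂ c := by
  unfold stepConst
  positivity

lemma sq_sum_five_le (a b c d e : ℝ) :
    (a + b + c + d + e) ^ 2 ≤ 5 * ((a ^ 2 + c ^ 2) + (b ^ 2 + d ^ 2) + e ^ 2) := by
  nlinarith [sq_nonneg (a - b), sq_nonneg (a - c), sq_nonneg (a - d), sq_nonneg (a - e),
    sq_nonneg (b - c), sq_nonneg (b - d), sq_nonneg (b - e), sq_nonneg (c - d),
    sq_nonneg (c - e), sq_nonneg (d - e)]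

/-- `F' - F'(0)` has the properties needed for the chain rule. -/
lemma chainFun_deriv_sub {F : ℝ → ℝ} (hF : ContDiff ℝ 2 F) {L : ℝ≥0}
    (hL : ∀ x, |iteratedDeriv 2 F x| ≤ L) : ChainFun (fun x => deriv F x - deriv F 0) L where
  contDiff := by
    have : ContDiff ℝ 1 (deriv F) := by
      have h : ContDiff ℝ (1 + 1) F := by norm_num; exact hF
      exact (contDiff_succ_iff_deriv.1 h).2.2
    exact this.sub contDiff_const
  zero := sub_self _
  bound := fun x => by
    rw [deriv_sub_const]
    simpa [iteratedDeriv_succ, iteratedDeriv_zero] using hL x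

lemma deriv_deriv_sub (F : ℝ → ℝ) (x : ℝ) :
    deriv (fun x => deriv F x - deriv F 0) x = iteratedDeriv 2 F x := by
  rw [deriv_sub_const, iteratedDeriv_succ, iteratedDeriv_succ, iteratedDeriv_zero]

lemma discreteNorm_le {X : Type*} [NormedAddCommGroup X] {N : ℕ} {f : ℕ → X} {r : ℝ}
    (h : ∀ n ≤ N, ‖f n‖ ≤ r) : discreteNorm N f ≤ r :=
  Finset.sup'_le _ _ fun n hn => h n (by simpa [Nat.lt_succ_iff] using hn)

lemma abs_le_max_toNNReal {L₁ L₂ x : ℝ} (h : |x| ≤ L₁ ∨ |x| ≤ L₂) :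
    |x| ≤ (max L₁ L₂).toNNReal :=
  (h.elim le_max_of_le_left le_max_of_le_right).trans (Real.le_coe_toNNReal _)

/-- Convergence of first order from the one-step energy estimate. -/
lemma discreteNorm_add_le_of_energy {X Y : Type*} [NormedAddCommGroup X] [NormedAddCommGroup Y]
    {e : ℕ → X} {E : ℕ → Y} {Z : ℕ → ℝ} {α c τ T : ℝ} {N : ℕ} (hα : 0 < α) (hα1 : α ≤ 1)
    (hc : 0 ≤ c) (hτ : 0 < τ) (hNT : N * τ = T) (hcτ : τ < 1 / (2 * (10 * c / α) + 1))
    (hZ : ∀ n, α * (‖e n‖ ^ 2 + ‖E n‖ ^ 2) ≤ Z n) (hZ0 : Z 0 = 0)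
    (hstep : ∀ n < N, Z (n + 1) - Z n ≤
      2 * τ * (c * (‖e (n + 1)‖ + ‖e n‖ + ‖E (n + 1)‖ + ‖E n‖ + τ) ^ 2)) :
    discreteNorm N e + discreteNorm N E ≤
      2 * Real.sqrt (Real.exp (4 * (10 * c / α) * T) / α) * τ := by
  -- The 10 is the 2 of the one-step estimate times the 5 of `sq_sum_five_le`; dividing by α turns
  -- norms into energies.
  set C := 10 * c / α with hCdef
  have hC : 0 ≤ C := by positivity
  have hCτ : C * τ ≤ 1 / 2 := by
    rw [lt_div_iff₀ (by positivity)] at hcτ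
    linarith
  have hstep' : ∀ n < N, Z (n + 1) - Z n ≤ τ * C * (Z (n + 1) + Z n + τ ^ 2) := by
    intro n hn
    refine (hstep n hn).trans ?_
    have h1 := sq_sum_five_le ‖e (n + 1)‖ ‖e n‖ ‖E (n + 1)‖ ‖E n‖ τ
    have h2 := hZ (n + 1)
    have h3 := hZ n
    have h4 : α * τ ^ 2 ≤ τ ^ 2 := mul_le_of_le_one_left (sq_nonneg τ) hα1
    have h5 := (mul_le_mul_of_nonneg_left h1 hα.le)
    have h6 : α * (‖e (n + 1)‖ + ‖e n‖ + ‖E (n + 1)‖ + ‖E n‖ + τ) ^ 2 ≤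
        5 * (Z (n + 1) + Z n + τ ^ 2) := by linarith
    have h7 := (le_div_iff₀' hα).2 h6
    calc 2 * τ * (c * _) ≤ 2 * τ * (c * (5 * (Z (n + 1) + Z n + τ ^ 2) / α)) := by gcongr
      _ = τ * C * (Z (n + 1) + Z n + τ ^ 2) := by rw [hCdef]; ring
  have hZpos : ∀ n, 0 ≤ Z n := fun n => le_trans (by positivity) (hZ n)
  have hfin : ∀ n ≤ N, ‖e n‖ ^ 2 + ‖E n‖ ^ 2 ≤
      (Real.sqrt (Real.exp (4 * C * T) / α) * τ) ^ 2 := fun n hn => by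
    have h1 := discrete_gronwall hC hτ hCτ hZpos hZ0 hstep' hn
    have hn' : n * τ ≤ T := hNT ▸ mul_le_mul_of_nonneg_right (Nat.cast_le.2 hn) hτ.le
    have h2 : Real.exp (4 * C * (n * τ)) ≤ Real.exp (4 * C * T) :=
      Real.exp_le_exp.2 (mul_le_mul_of_nonneg_left hn' (by positivity))
    have h3 := (hZ n).trans (h1.trans (mul_le_mul_of_nonneg_right h2 (sq_nonneg τ)))
    rw [mul_pow, Real.sq_sqrt (by positivity), div_mul_eq_mul_div]
    exact (le_div_iff₀' hα).2 h3
  have hr : 0 ≤ Real.sqrt (Real.exp (4 * C * T) / α) * τ := by positivity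
  have b1 : discreteNorm N e ≤ _ := discreteNorm_le fun n hn =>
    le_of_sq_le_sq ((le_add_of_nonneg_right (sq_nonneg _)).trans (hfin n hn)) hr
  have b2 : discreteNorm N E ≤ _ := discreteNorm_le fun n hn =>
    le_of_sq_le_sq ((le_add_of_nonneg_left (sq_nonneg _)).trans (hfin n hn)) hr
  linarith

end KLLM

set_option maxHeartbeats 1000000 in
theorem theorem2 {d k : ℕ} (hd : d = 2 ∨ d = 3) (hk : 3 ≤ k)
    (Ω : Set (EuclideanSpace ℝ (Fin d))) (hΩo : IsOpen Ω) (hΩc : IsConnected Ω)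
    (hΩb : Bornology.IsBounded Ω) (hΩk : KLLM.HasBoundaryCkLip k Ω)
    (ε δ κ K s₁ s₂ T : ℝ) (hε : 0 < ε) (hδ : 0 < δ) (hκ : 0 < κ) (hK : 0 < K)
    (hs₁ : 0 < s₁) (hs₂ : 0 < s₂) (hT : 0 < T)
    (F G : ℝ → ℝ) (hF : ContDiff ℝ 2 F) (hG : ContDiff ℝ 2 G)
    (L₁ L₂ K₁ K₂ : ℝ)
    (hFlip : ∀ x y, |iteratedDeriv 2 F x - iteratedDeriv 2 F y| ≤ K₁ * |x - y|)
    (hGlip : ∀ x y, |iteratedDeriv 2 G x - iteratedDeriv 2 G y| ≤ K₂ * |x - y|)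
    (hFbdd : ∀ x, |iteratedDeriv 2 F x| ≤ L₁) (hGbdd : ∀ x, |iteratedDeriv 2 G x| ≤ L₂)
    (φ μ : ℝ → KLLM.H1Bulk Ω) (ψ μΓ : ℝ → KLLM.H1Surf Ω)
    (hsol : KLLM.IsKLLMSolution Ω F G ε δ κ K T φ μ ψ μΓ)
    (hreg : KLLM.IsRegular Ω T φ ψ) :
    ∃ τ₀ > 0, ∃ C : ℝ, ∀ N : ℕ, 0 < N → T / N < τ₀ →
      ∀ (φₙ μₙ : ℕ → KLLM.H1Bulk Ω) (ψₙ μΓₙ : ℕ → KLLM.H1Surf Ω),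
        KLLM.IsSchemeSolution Ω F G ε δ κ K s₁ s₂ (T / N) N (φ 0) (ψ 0) φₙ μₙ ψₙ μΓₙ →
        KLLM.discreteNorm N (fun n => φ (n * (T / N)) - φₙ n) +
          KLLM.discreteNorm N (fun n => ψ (n * (T / N)) - ψₙ n) ≤ C * (T / N) := by
  obtain ⟨hφ, hψ, M₀, hM₀⟩ := hreg
  obtain ⟨cφ, hcφ, hbφ⟩ := hφ.exists_bound hT
  obtain ⟨cψ, hcψ, hbψ⟩ := hψ.exists_bound hT
  set c₀ := max cφ cψ
  have hc₀ : 0 ≤ c₀ := le_max_of_le_left hcφ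
  set M := max M₀ 0
  have hM : 0 ≤ M := le_max_right _ _
  set q := max (max K₁ K₂) 0
  have hq : 0 ≤ q := le_max_right _ _
  set L := (max L₁ L₂).toNNReal
  -- Subtracting F'(0) gives a function vanishing at 0, as composition in L² requires; the constant
  -- cancels in the error equations.
  have hpF := KLLM.chainFun_deriv_sub hF (L := L)
    fun x => KLLM.abs_le_max_toNNReal (Or.inl (hFbdd x))
  have hpG := KLLM.chainFun_deriv_sub hG (L := L)
    fun x => KLLM.abs_le_max_toNNReal (Or.inr (hGbdd x))
  have hqF : ∀ x y, |deriv (fun x => deriv F x - deriv F 0) x -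
      deriv (fun x => deriv F x - deriv F 0) y| ≤ q * |x - y| := fun x y => by
    rw [KLLM.deriv_deriv_sub, KLLM.deriv_deriv_sub]
    exact (hFlip x y).trans (mul_le_mul_of_nonneg_right
      (le_max_of_le_left (le_max_left _ _)) (abs_nonneg _))
  have hqG : ∀ x y, |deriv (fun x => deriv G x - deriv G 0) x -
      deriv (fun x => deriv G x - deriv G 0) y| ≤ q * |x - y| := fun x y => by
    rw [KLLM.deriv_deriv_sub, KLLM.deriv_deriv_sub]
    exact (hGlip x y).trans (mul_le_mul_of_nonneg_right
      (le_max_of_le_left (le_max_right _ _)) (abs_nonneg _))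
  have htr : ∀ t ∈ Icc 0 T, KLLM.HasTrace (φ t) (KLLM.fn (ψ t)) := fun t ht =>
    KLLM.hasTrace_of_forall_Ioc hT hφ.1.continuousOn hψ.1.continuousOn (fun t ht => by
      obtain ⟨_, _, _, _, _, _, _, _, _, _, _, _, _, _, _, _, _, h, _, _⟩ := hsol t ht
      exact h) ht
  have hcomp : ∀ t ∈ Icc 0 T, (φ t, ψ t) ∈ KLLM.compatible Ω := fun t ht =>
    (htr t ht).mem_compatible hΩo
  have hν : 0 < δ * κ := mul_pos hδ hκ
  set Cs := KLLM.stepConst ε (δ * κ) δ K s₁ s₂ ((q * M + L + 1) * (c₀ + 1))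
  have hCs : 0 ≤ Cs := KLLM.stepConst_nonneg hε hν hK hs₁ hs₂ (by positivity)
  set α := min 1 (min ε (δ * κ))
  have hα : 0 < α := lt_min one_pos (lt_min hε hν)
  have hα1 : α ≤ 1 := min_le_left _ _
  -- This threshold keeps the Gronwall constant times τ below 1/2; the added 1 keeps the denominator
  -- positive even if Cs = 0.
  refine ⟨1 / (2 * (10 * Cs / α) + 1), by positivity,
    2 * Real.sqrt (Real.exp (4 * (10 * Cs / α) * T) / α), ?_⟩
  intro N hN hNτ φₙ μₙ ψₙ μΓₙ ⟨h0φ, h0ψ, hscheme⟩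
  have hN' : (0 : ℝ) < N := Nat.cast_pos.2 hN
  set τ := T / N with hτdef
  have hτ : 0 < τ := div_pos hT hN'
  have hNT : N * τ = T := by rw [hτdef]; field_simp
  have htime : ∀ n ≤ N, n * τ ≤ T := fun n hn => by
    rw [← hNT]
    exact mul_le_mul_of_nonneg_right (Nat.cast_le.2 hn) hτ.le
  have htime0 : ∀ n : ℕ, 0 ≤ n * τ := fun n => by positivity
  refine KLLM.discreteNorm_add_le_of_energy
    (Z := fun n => KLLM.energy ε (δ * κ) (φ (n * τ) - φₙ n) (ψ (n * τ) - ψₙ n))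
    hα hα1 hCs hτ hNT hNτ (fun n => KLLM.min_mul_norm_sq_le_energy _ _) ?_ ?_
  · simp only [h0φ, h0ψ, Nat.cast_zero, zero_mul, sub_self]
    simp [KLLM.energy, KLLM.fn, KLLM.grad]
  · intro n hn
    have hsucc : ((n + 1 : ℕ) : ℝ) * τ - n * τ = τ := by push_cast; ring
    have hlt : n * τ < ((n + 1 : ℕ) : ℝ) * τ := by linarith
    have hmem : ((n + 1 : ℕ) : ℝ) * τ ∈ Ioc 0 T :=
      ⟨(htime0 n).trans_lt hlt, htime _ hn⟩
    have hmem' := Ioc_subset_Icc_self hmem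
    have hmemn : n * τ ∈ Icc 0 T := ⟨htime0 n, htime n hn.le⟩
    have h₀ : KLLM.HasTrace (φₙ n) (KLLM.fn (ψₙ n)) := by
      -- At n = 0 the trace relation comes from the exact initial data, afterwards from the
      -- preceding scheme step.
      cases n with
      | zero => rw [h0φ, h0ψ]; exact htr 0 ⟨le_rfl, hT.le⟩
      | succ j =>
        obtain ⟨_, _, _, _, _, _, _, _, _, _, _, _, _, _, _, _, _, h, _, _⟩ :=
          hscheme j (by omega)
        exact h
    obtain ⟨a1, a2⟩ := hbφ _ _ (htime0 n) hlt hmem.2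
    obtain ⟨a3, a4⟩ := hbψ _ _ (htime0 n) hlt hmem.2
    rw [hsucc] at a1 a2 a3 a4
    have m1 : cφ * τ ≤ c₀ * τ := mul_le_mul_of_nonneg_right (le_max_left _ _) hτ.le
    have m2 : cψ * τ ≤ c₀ * τ := mul_le_mul_of_nonneg_right (le_max_right _ _) hτ.le
    exact KLLM.energy_sub_energy_le hΩo hε hδ hκ hK hs₁ hs₂ hτ hq hM hc₀ hpF hpG
      (fun x => (sub_add_cancel _ _).symm) (fun x => (sub_add_cancel _ _).symm) hqF hqG
      (hsol _ hmem) (hscheme n hn) (hcomp _ hmemn)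
      (KLLM.derivWithin_mem_compatible hT hφ.1 hψ.1 hcomp hmem') h₀ (a1.trans m1) (a3.trans m2)
      (a2.trans m1) (a4.trans m2)
      ((hM₀ _ hmem').1.mono fun x hx => hx.trans (le_max_left _ _))
      ((hM₀ _ hmem').2.mono fun x hx => hx.trans (le_max_left _ _))
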